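/- **Lemma (asymptotic normality of the symmetric quadratic form for SRHT).** *Setup.* Let $H_0=1$ and $H_{t+1}=\frac1{\sqrt2}\begin{pmatrix}H_t&H_t\\H_t&-H_t\end{pmatrix}$ for $t\ge0$. For $n\ge 1$ put $n'=2^{l}$ with $l=\lceil\log_2 n\rceil$, the smallest power of two that is at least $n$ (so $n'=n$ if $n$ is a power of two). For $m\le n'$, an SRHT sketching matrix is $$S_{m,n}=\sqrt{n'/m}\;B\,H_l\,D\,\Pi_n ,$$ where $B$ is an $n'\times n'$ diagonal matrix with i.i.d. Bernoulli diagonal entries with success probability $\gamma_n:=m/n'$, $D$ is an $n'\times n'$ diagonal matrix with i.i.d. Rademacher ($\pm1$) diagonal entries, $B$ and $D$ are independent, and $\Pi_n$ is the $n'\times n$ zero-padding matrix $\begin{pmatrix}I_n\\0\end{pmatrix}$ (so $\Pi_n=I_n$ and $\gamma_n=m/n$ if $n$ is a power of two). For $A\in\mathbb R^{p\times p}$ let $\mathrm{vec}(A)\in\mathbb R^{p^2}$ be its vectorization, with coordinates $\mathrm{vec}(A)_{(i,j)}=A_{ij}$. Let $P_p$ be the $p^2\times p^2$ matrix with $(P_p)_{(ij),(kl)}=\delta_{il}\delta_{jk}$,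 and let $Q_p=\mathrm{vec}(I_p)\mathrm{vec}(I_p)^\top$. *Claim.* Fix $p$. Consider a sequence of sizes $n=n_k\to\infty$ and $m=m_k\le n'_k$, deterministic $n\times p$ matrices $U_n$ with $U_n^\top U_n=I_p$, and SRHT matrices $S_{m,n}$. Assume that $$\max_{1\le i\le n}\|U_{i:}\|\to0,\qquad \frac{m}{\log^2 n}\to\infty,\qquad \limsup \gamma_n<1,$$ where $U_{i:}$ is the $i$-th row of $U_n$ (its squared norm is the $i$-th leverage score). Then the $p^2\times p^2$ matrix $G=I_{p^2}+P_p+Q_p$ is positive semidefinite, satisfies $\mathrm{vec}(ab^\top)^\top G\,\mathrm{vec}(ab^\top)>0$ for all nonzero $a,b\in\mathbb R^p$, and $$\sqrt{\frac{m}{1-\gamma_n}}\;\mathrm{vec}\bigl(U_n^\top S_{m,n}^\top S_{m,n}U_n-I_p\bigr)\Rightarrow \mathcal N(0,G)$$ in distribution. -/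

import Mathlib

open MeasureTheory ProbabilityTheory Filter Topology

namespace SRHT

/-- The normalized Hadamard matrices: `H_0 = 1` and
`H_{t+1} = (1/√2) * [[H_t, H_t], [H_t, -H_t]]`. -/
noncomputable def hadamardMatrix : (t : ℕ) → Matrix (Fin (2 ^ t)) (Fin (2 ^ t)) ℝ
  | 0 => 1
  | t + 1 =>
    let e : Fin (2 ^ t) ⊕ Fin (2 ^ t) ≃ Fin (2 ^ (t + 1)) :=
      finSumFinEquiv.trans (finCongr (by rw [pow_succ]; omega))
    (1 / Real.sqrt 2) •
      (Matrix.fromBlocks (hadamardMatrix t) (hadamardMatrix t)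
        (hadamardMatrix t) (-hadamardMatrix t)).reindex e e

/-- The zero-padding matrix `[I_n; 0]` with `N` rows and `n` columns. -/
def paddingMatrix (N n : ℕ) : Matrix (Fin N) (Fin n) ℝ :=
  Matrix.of fun i j => if (i : ℕ) = (j : ℕ) then 1 else 0

/-- The exponent `l = ⌈log₂ n⌉`, so that `2 ^ l` is the smallest power of two that is at
least `n`. -/
def exponent (n : ℕ) : ℕ := Nat.clog 2 n

/-- The sampling rate `γ = m / 2 ^ ⌈log₂ n⌉`, which is `m / n` if `n` is a power of two. -/
noncomputable def rate (m n : ℕ) : ℝ := (m : ℝ) / (2 : ℝ) ^ exponent n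

theorem rate_mem {m n : ℕ} (h : m ≤ 2 ^ exponent n) : rate m n ∈ unitInterval := by
  refine ⟨by unfold rate; positivity, ?_⟩
  unfold rate
  rw [div_le_one (by positivity)]
  exact_mod_cast h

/-- The law of a Bernoulli variable with values in `{0, 1} ⊆ ℝ` and success probability `q`. -/
noncomputable def bernoulliLaw (q : unitInterval) : Measure ℝ := bernoulliMeasure (1 : ℝ) 0 q

/-- The law of a Rademacher variable: `1` and `-1` with probability `1/2` each. -/
noncomputable def rademacherLaw : Measure ℝ :=
  bernoulliMeasure (1 : ℝ) (-1) ⟨1 / 2, by norm_num, by norm_num⟩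

/-- `S` is a subsampled randomized Hadamard transform sketching matrix for data with `n` rows,
with sketch size `m`: with `l = ⌈log₂ n⌉`, almost surely
`S = √(2 ^ l / m) * diag(B) * H_l * diag(D) * Π`, where the `B i` are Bernoulli with success
probability `m / 2 ^ l`, the `D i` are Rademacher, all of these variables are independent, and
`Π` pads with zeroes (`Π = 1` if `n` is a power of two). -/
def IsSRHT {Ω : Type*} [MeasurableSpace Ω] (P : Measure Ω) (m n : ℕ)
    (S : Ω → Matrix (Fin (2 ^ exponent n)) (Fin n) ℝ) : Prop :=
  ∃ (hm : m ≤ 2 ^ exponent n) (B D : Fin (2 ^ exponent n) → Ω → ℝ),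
    iIndepFun (Sum.elim B D) P ∧
    (∀ i, HasLaw (B i) (bernoulliLaw ⟨rate m n, rate_mem hm⟩) P) ∧
    (∀ i, HasLaw (D i) rademacherLaw P) ∧
    ∀ᵐ ω ∂P, S ω = Real.sqrt ((2 : ℝ) ^ exponent n / m) •
      (Matrix.diagonal (fun i => B i ω) * hadamardMatrix (exponent n) *
        Matrix.diagonal (fun i => D i ω) * paddingMatrix (2 ^ exponent n) n)

/-- The largest Euclidean norm of a row of `U` (the square root of the largest leverage score,
if the columns of `U` are orthonormal). -/
noncomputable def maxRowNorm {n p : ℕ} (U : Matrix (Fin n) (Fin p) ℝ) : ℝ :=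
  ⨆ i : Fin n, ‖WithLp.toLp 2 (U i)‖

/-- Vectorization, with the coordinates of `ℝ^{p²}` indexed by pairs: `vec(A)_{(i,j)} = A_{ij}`. -/
def vec {p : ℕ} (A : Matrix (Fin p) (Fin p) ℝ) : Fin p × Fin p → ℝ := fun ij => A ij.1 ij.2

/-- The matrix of transposition: `(P_p)_{ij,kl} = δ_{il} δ_{jk}`. -/
def transpositionMatrix (p : ℕ) : Matrix (Fin p × Fin p) (Fin p × Fin p) ℝ :=
  Matrix.of fun ij kl => if ij.1 = kl.2 ∧ ij.2 = kl.1 then 1 else 0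

/-- `Q_p = vec(I_p) vec(I_p)ᵀ`. -/
def identityOuter (p : ℕ) : Matrix (Fin p × Fin p) (Fin p × Fin p) ℝ :=
  Matrix.vecMulVec (vec 1) (vec 1)

/-- `G = I_{p²} + P_p + Q_p`. -/
def limitCov (p : ℕ) : Matrix (Fin p × Fin p) (Fin p × Fin p) ℝ :=
  1 + transpositionMatrix p + identityOuter p

/-- The normalized quadratic form `√(m / (1 - γ)) vec(Uᵀ Sᵀ S U - I_p)`. -/
noncomputable def quadForm {n p : ℕ} (m : ℕ) (U : Matrix (Fin n) (Fin p) ℝ)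
    (S : Matrix (Fin (2 ^ exponent n)) (Fin n) ℝ) : EuclideanSpace ℝ (Fin p × Fin p) :=
  Real.sqrt ((m : ℝ) / (1 - rate m n)) •
    WithLp.toLp 2 (vec (U.transpose * S.transpose * S * U - 1))

end SRHT

namespace SRHT

/-! ### Hadamard matrices -/

/-! By Lévy's continuity theorem it is enough to find the limit of the characteristic function at a
matrix direction `T`. Write `N = 2 ^ l`, `q = γ`, and `V` for the padded `U`. The rows of `H D V`
have outer products summing to `I`, so the centred form in direction `T` is `∑ ξ_i y_i`, where the
`ξ_i` are independent standardized Bernoulli variables and `y_i = rowForm` depends on the signs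
only. Integrating out the sampling given the signs leaves the expectation over signs of `∏
φ_q(y_i)`, with `φ_q = bernoulliCharFun q`.

Two estimates finish the proof. First, `φ_q(y)` differs from `exp(-y²/2)` by at most `5 |y|³ /
√(q(1-q))`. Khintchine's inequality bounds `E|y_i|³` by a multiple of `N^(-3/2)`, so the total error
has order `(N q (1-q))^(-1/2) = (m(1-γ))^(-1/2)`.

Second, `∑ y_i²` converges in `L¹` to `limitForm T`, the quadratic form of `G`
(`IsHadamard.integral_abs_sum_quadratic_sq_sub_le`). It is a polynomial of degree four in the signs.
The three ways of pairing four indices produce the three terms of `limitForm`, up to a diagonal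
correction. The quadruples of distinct indices give a Walsh polynomial whose `L²` norm is small by
orthogonality. Both errors are controlled by the largest leverage score. -/

theorem hadamardMatrix_sq (t : ℕ) (i j : Fin (2 ^ t)) : hadamardMatrix t i j ^ 2 = 1 / 2 ^ t := by
  induction t with
  | zero =>
    obtain rfl : i = j := Fin.ext (by omega)
    simp [hadamardMatrix]
  | succ t ih =>
    have h2 : (Real.sqrt 2)⁻¹ ^ 2 = 1 / 2 := by rw [inv_pow, Real.sq_sqrt (by norm_num)]; norm_num
    simp only [hadamardMatrix, Matrix.smul_apply, Matrix.reindex_apply, Matrix.submatrix_apply,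
      smul_eq_mul, mul_pow, one_div, h2]
    generalize (Equiv.symm _ : Fin (2 ^ (t + 1)) ≃ Fin (2 ^ t) ⊕ Fin (2 ^ t)) i = a
    generalize (Equiv.symm _ : Fin (2 ^ (t + 1)) ≃ Fin (2 ^ t) ⊕ Fin (2 ^ t)) j = b
    rcases a with a | a <;> rcases b with b | b <;>
      simp [ih, pow_succ (2 : ℝ), mul_comm]

theorem hadamardMatrix_transpose_mul_self (t : ℕ) :
    (hadamardMatrix t).transpose * hadamardMatrix t = 1 := by
  induction t with
  | zero => simp [hadamardMatrix]
  | succ t ih =>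
    have h2 : (Real.sqrt 2)⁻¹ * (Real.sqrt 2)⁻¹ = 1 / 2 := by
      rw [← mul_inv, Real.mul_self_sqrt (by norm_num)]; norm_num
    have h3 : (1 / 2 : ℝ) • (1 + 1 : Matrix (Fin (2 ^ t)) (Fin (2 ^ t)) ℝ) = 1 := by
      rw [← two_smul ℝ, smul_smul]; norm_num
    simp only [hadamardMatrix, Matrix.transpose_smul, Matrix.smul_mul, Matrix.mul_smul, smul_smul,
      Matrix.reindex_apply, Matrix.transpose_submatrix, Matrix.submatrix_mul_equiv,
      Matrix.fromBlocks_transpose, Matrix.fromBlocks_multiply, one_div, h2, Matrix.transpose_neg,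
      Matrix.neg_mul, Matrix.mul_neg, ih, neg_neg, add_neg_cancel]
    have : ((2 : ℝ)⁻¹ • (Matrix.fromBlocks (1 + 1) 0 0 (1 + 1) :
        Matrix (Fin (2 ^ t) ⊕ Fin (2 ^ t)) (Fin (2 ^ t) ⊕ Fin (2 ^ t)) ℝ)) = 1 := by
      rw [Matrix.fromBlocks_smul]
      simp only [one_div] at h3
      rw [h3, smul_zero, Matrix.fromBlocks_one]
    refine (congrArg (fun A => Matrix.submatrix A _ _) this).trans ?_
    exact Matrix.submatrix_one_equiv _

/-! ### Fair coins -/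

section Coins

variable {ι : Type*} [Fintype ι]

/-- The sign of a coin. -/
def sgn (b : Bool) : ℝ := if b then 1 else -1

theorem sgn_mul_self (b : Bool) : sgn b * sgn b = 1 := by cases b <;> simp [sgn]

/-- The law of independent coins with success probability `q`. -/
noncomputable def coins (ι : Type*) [Fintype ι] (q : unitInterval) : Measure (ι → Bool) :=
  Measure.pi fun _ => bernoulliMeasure true false q

instance (q : unitInterval) : IsProbabilityMeasure (coins ι q) := by
  unfold coins; infer_instance

/-- The success probability of a fair coin. -/
noncomputable def half : unitInterval := ⟨1 / 2, by norm_num, by norm_num⟩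

theorem integral_coins_prod {𝕜 : Type*} [RCLike 𝕜] (q : unitInterval) (f : ι → Bool → 𝕜) :
    ∫ x, ∏ j, f j (x j) ∂(coins ι q) =
      ∏ j, ((q : ℝ) • f j true + (1 - q : ℝ) • f j false) := by
  unfold coins
  rw [integral_fintype_prod_eq_prod (f := f)]
  simp_rw [integral_bernoulliMeasure]

/-- The integral factors into terms `cosh (c j)`, each at most `exp (c j ^ 2 / 2)`. -/
theorem integral_exp_sum_sgn_le (c : ι → ℝ) :
    ∫ ω, Real.exp (∑ j, c j * sgn (ω j)) ∂(coins ι half) ≤ Real.exp ((∑ j, c j ^ 2) / 2) := by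
  simp_rw [Real.exp_sum]
  rw [integral_coins_prod half (fun j b => Real.exp (c j * sgn b)), Finset.sum_div, Real.exp_sum]
  refine Finset.prod_le_prod (fun j _ => ?_) fun j _ => ?_
  · simp only [half, smul_eq_mul]; norm_num; positivity
  · refine le_trans (le_of_eq ?_) (Real.cosh_le_exp_half_sq (c j))
    simp [Real.cosh_eq, half, sgn]; ring

/-- All terms of the power series of `cosh` are nonnegative; this keeps the one of degree six, with
`720 = 6!`. -/
theorem pow_six_le_cosh (x : ℝ) : x ^ 6 ≤ 720 * Real.cosh x := by
  have h := le_hasSum (Real.hasSum_cosh x) 3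
    (fun j _ => div_nonneg (by rw [pow_mul]; positivity) (by positivity))
  norm_num [Nat.factorial] at h
  linarith

/-- Khintchine's inequality for sixth moments. -/
theorem integral_sum_sgn_pow_six_le (c : ι → ℝ) (hc : ∑ j, c j ^ 2 = 1) :
    ∫ ω, (∑ j, c j * sgn (ω j)) ^ 6 ∂(coins ι half) ≤ 720 * Real.exp (1 / 2) := by
  have h1 := integral_exp_sum_sgn_le c
  have h2 := integral_exp_sum_sgn_le (fun j => -c j)
  simp only [neg_sq, hc, neg_mul, Finset.sum_neg_distrib] at h1 h2
  calc _ ≤ ∫ ω, (360 * Real.exp (∑ j, c j * sgn (ω j)) + 360 * Real.exp (-∑ j, c j * sgn (ω j)))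
        ∂(coins ι half) := by
        refine integral_mono Integrable.of_finite Integrable.of_finite fun ω => ?_
        refine (pow_six_le_cosh _).trans (le_of_eq ?_)
        rw [Real.cosh_eq]; ring
    _ ≤ _ := by
      rw [integral_add Integrable.of_finite Integrable.of_finite, integral_const_mul,
        integral_const_mul]
      linarith

variable [DecidableEq ι]

/-- Orthonormality of the Walsh functions: a coin in exactly one of the two sets contributes a
factor of mean zero, and any other coin contributes 1. -/
theorem integral_sgn_prod_mul_prod (A B : Finset ι) :
    ∫ x, (∏ j ∈ A, sgn (x j)) * ∏ j ∈ B, sgn (x j) ∂(coins ι half) = if A = B then 1 else 0 := by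
  have h : ∀ x : ι → Bool, (∏ j ∈ A, sgn (x j)) * ∏ j ∈ B, sgn (x j) =
      ∏ j, ((if j ∈ A then sgn (x j) else 1) * (if j ∈ B then sgn (x j) else 1)) := by
    intro x
    rw [Finset.prod_mul_distrib]
    simp
  simp_rw [h]
  rw [integral_coins_prod half
    (fun j b => (if j ∈ A then sgn b else 1) * (if j ∈ B then sgn b else 1))]
  split_ifs with hAB
  · subst hAB
    refine Finset.prod_eq_one fun j _ => ?_
    split_ifs <;> norm_num [sgn, half]
  · obtain ⟨j, hj⟩ : ∃ j, ¬ (j ∈ A ↔ j ∈ B) := by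
      by_contra! h
      exact hAB (Finset.ext h)
    refine Finset.prod_eq_zero (Finset.mem_univ j) ?_
    by_cases hA : j ∈ A <;> by_cases hB : j ∈ B <;> simp_all [sgn, half] <;> norm_num

/-- Walsh polynomials whose index map is at most `C` to one have a second moment bounded by `C`
times the sum of the squares of their coefficients. -/
theorem integral_sum_walsh_sq_le {κ : Type*} [Fintype κ] (A : κ → Finset ι) (a : κ → ℝ) (C : ℕ)
    (hC : ∀ x, (Finset.univ.filter fun y => A x = A y).card ≤ C) :
    ∫ ω, (∑ x, a x * ∏ j ∈ A x, sgn (ω j)) ^ 2 ∂(coins ι half) ≤ C * ∑ x, a x ^ 2 := by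
  have h1 : ∫ ω, (∑ x, a x * ∏ j ∈ A x, sgn (ω j)) ^ 2 ∂(coins ι half) =
      ∑ x, ∑ y, if A x = A y then a x * a y else 0 := by
    simp_rw [sq, Finset.sum_mul_sum]
    rw [integral_finsetSum _ fun _ _ => Integrable.of_finite]
    refine Finset.sum_congr rfl fun x _ => ?_
    rw [integral_finsetSum _ fun _ _ => Integrable.of_finite]
    refine Finset.sum_congr rfl fun y _ => ?_
    simp_rw [mul_mul_mul_comm]
    rw [integral_const_mul, integral_sgn_prod_mul_prod]
    simp
  have h2 : ∀ x, (∑ y, if A x = A y then a x ^ 2 else 0) ≤ C * a x ^ 2 := by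
    intro x
    rw [← Finset.sum_filter, Finset.sum_const, nsmul_eq_mul]
    exact mul_le_mul_of_nonneg_right (by exact_mod_cast hC x) (sq_nonneg _)
  have h3 : (∑ x, ∑ y, if A x = A y then a y ^ 2 else 0) =
      ∑ x, ∑ y, if A x = A y then a x ^ 2 else 0 := by
    rw [Finset.sum_comm]
    simp_rw [eq_comm]
  calc _ = ∑ x, ∑ y, if A x = A y then a x * a y else 0 := h1
    -- `2uv ≤ u² + v²`; by symmetry both halves have the same sum, and each `x` meets at most `C`
    -- indices `y`.
    _ ≤ ∑ x, ∑ y, ((if A x = A y then a x ^ 2 else 0) + if A x = A y then a y ^ 2 else 0) / 2 := by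
      refine Finset.sum_le_sum fun x _ => Finset.sum_le_sum fun y _ => ?_
      split_ifs
      · nlinarith [sq_nonneg (a x - a y)]
      · simp
    _ = ∑ x, ∑ y, if A x = A y then a x ^ 2 else 0 := by
      simp_rw [← Finset.sum_div, Finset.sum_add_distrib, h3]
      ring
    _ ≤ ∑ x, C * a x ^ 2 := Finset.sum_le_sum fun x _ => h2 x
    _ = _ := by rw [Finset.mul_sum]

end Coins

/-! ### Quadratic forms of a randomized Hadamard transform -/

section Chaos

variable {ι : Type*} [Fintype ι]

/-- The normalized sum of a product of four columns. -/
noncomputable def quadCoeff (K : Matrix ι ι ℝ) (j k l m : ι) : ℝ :=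
  (Fintype.card ι : ℝ)⁻¹ * ∑ i, K i j * K i k * K i l * K i m

variable {K : Matrix ι ι ℝ}

theorem quadCoeff_swap_right (j k l m : ι) : quadCoeff K j k l m = quadCoeff K j k m l := by
  unfold quadCoeff; congr 1; exact Finset.sum_congr rfl fun i _ => by ring

theorem quadCoeff_swap_mid (j k l m : ι) : quadCoeff K j k l m = quadCoeff K j l k m := by
  unfold quadCoeff; congr 1; exact Finset.sum_congr rfl fun i _ => by ring

theorem quadCoeff_swap_pairs (j k l m : ι) : quadCoeff K j k l m = quadCoeff K l m j k := by
  unfold quadCoeff; congr 1; exact Finset.sum_congr rfl fun i _ => by ring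

variable [DecidableEq ι]

/-- An (unnormalized) Hadamard matrix: signs as entries, orthogonal columns. -/
structure IsHadamard (K : Matrix ι ι ℝ) : Prop where
  sq_apply : ∀ i j, K i j ^ 2 = 1
  transpose_mul_self : K.transpose * K = (Fintype.card ι : ℝ) • (1 : Matrix ι ι ℝ)

theorem IsHadamard.sum_col_mul_col (hK : IsHadamard K) (j k : ι) :
    ∑ i, K i j * K i k = if j = k then (Fintype.card ι : ℝ) else 0 := by
  have := congrFun (congrFun hK.transpose_mul_self j) k
  simpa [Matrix.mul_apply, Matrix.one_apply] using this

/-- The support of a quadruple. -/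
def quadSupport (x : ι × ι × ι × ι) : Finset ι := {x.1, x.2.1, x.2.2.1, x.2.2.2}

/-- A quadruple with a given support takes its four entries in a set of at most four elements, which
leaves at most `4 ^ 4` choices. -/
theorem card_quadSupport_eq_le (x : ι × ι × ι × ι) :
    (Finset.univ.filter fun y => quadSupport x = quadSupport y).card ≤ 256 := by
  have h1 : (quadSupport x).card ≤ 4 := Finset.card_le_four
  calc _ ≤ (quadSupport x ×ˢ quadSupport x ×ˢ quadSupport x ×ˢ quadSupport x).card := by
        refine Finset.card_le_card fun y hy => ?_
        rw [Finset.mem_filter] at hy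
        rw [hy.2]
        simp [quadSupport]
    _ = (quadSupport x).card ^ 4 := by simp only [Finset.card_product]; ring
    _ ≤ 4 ^ 4 := Nat.pow_le_pow_left h1 4
    _ = 256 := by norm_num

variable [Nonempty ι]

/-- A one-sided inverse of a square matrix is two-sided, so orthogonality of columns passes to rows.
-/
theorem IsHadamard.sum_row_mul_row (hK : IsHadamard K) (i j : ι) :
    ∑ m, K i m * K j m = if i = j then (Fintype.card ι : ℝ) else 0 := by
  have hN : (Fintype.card ι : ℝ) ≠ 0 := by simp
  have h1 : ((Fintype.card ι : ℝ)⁻¹ • K.transpose) * K = 1 := by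
    rw [Matrix.smul_mul, hK.transpose_mul_self, smul_smul, inv_mul_cancel₀ hN, one_smul]
  rw [mul_eq_one_comm, Matrix.mul_smul] at h1
  have h2 := congrFun (congrFun h1 i) j
  simp only [Matrix.smul_apply, Matrix.mul_apply, Matrix.transpose_apply, smul_eq_mul,
    Matrix.one_apply] at h2
  rw [inv_mul_eq_iff_eq_mul₀ hN] at h2
  simpa using h2

/-- A repeated column squares to the constant 1, and column orthogonality decides the rest. Together
with the symmetries of `quadCoeff` this evaluates every quadruple with a coincidence. -/
theorem IsHadamard.quadCoeff_self (hK : IsHadamard K) (j l m : ι) :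
    quadCoeff K j j l m = if l = m then 1 else 0 := by
  have hN : (Fintype.card ι : ℝ) ≠ 0 := by simp
  unfold quadCoeff
  simp_rw [← sq, hK.sq_apply, one_mul, hK.sum_col_mul_col]
  split_ifs <;> simp [hN]

/-- Parseval: the product of three columns is a vector of signs, and these are its coefficients in
the orthogonal basis of columns. This is what makes the off-diagonal part small. -/
theorem IsHadamard.sum_quadCoeff_sq (hK : IsHadamard K) (j k l : ι) :
    ∑ m, quadCoeff K j k l m ^ 2 = 1 := by
  have hN : (Fintype.card ι : ℝ) ≠ 0 := by simp
  have h : ∀ i, (K i j * K i k * K i l) ^ 2 = 1 := fun i => by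
    rw [mul_pow, mul_pow, hK.sq_apply, hK.sq_apply, hK.sq_apply]; norm_num
  calc ∑ m, quadCoeff K j k l m ^ 2
      = (Fintype.card ι : ℝ)⁻¹ ^ 2 * ∑ i, ∑ i', (K i j * K i k * K i l) *
          (K i' j * K i' k * K i' l) * ∑ m, K i m * K i' m := by
        simp_rw [quadCoeff, mul_pow, ← Finset.mul_sum, sq (∑ i, _), Finset.sum_mul_sum]
        congr 1
        rw [Finset.sum_comm]
        refine Finset.sum_congr rfl fun i _ => ?_
        rw [Finset.sum_comm]
        refine Finset.sum_congr rfl fun i' _ => ?_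
        rw [Finset.mul_sum]
        exact Finset.sum_congr rfl fun m _ => by ring
    _ = 1 := by
        simp_rw [hK.sum_row_mul_row, mul_ite, mul_zero, Finset.sum_ite_eq, Finset.mem_univ, if_true,
          ← sq, h]
        simp
        field_simp

/-- The coefficients of the off-diagonal part of the squared quadratic form. -/
noncomputable def offCoeff (K M : Matrix ι ι ℝ) (x : ι × ι × ι × ι) : ℝ :=
  if x.1 ≠ x.2.1 ∧ x.1 ≠ x.2.2.1 ∧ x.1 ≠ x.2.2.2 ∧ x.2.1 ≠ x.2.2.1 ∧ x.2.1 ≠ x.2.2.2 ∧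
    x.2.2.1 ≠ x.2.2.2 then
    quadCoeff K x.1 x.2.1 x.2.2.1 x.2.2.2 * (M x.1 x.2.1 * M x.2.2.1 x.2.2.2) else 0

/-- If two indices coincide, the coefficient vanishes unless the other two coincide as well, so only
the three pairings survive. The quadruple with all indices equal belongs to all three pairings,
hence the correction by 2. -/
theorem IsHadamard.quadCoeff_mul_eq (hK : IsHadamard K) (M : Matrix ι ι ℝ) (s : ι → ℝ)
    (hs : ∀ j, s j * s j = 1) (j k l m : ι) :
    quadCoeff K j k l m * (M j k * M l m) * (s j * s k * (s l * s m)) =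
      offCoeff K M (j, k, l, m) * (∏ i ∈ quadSupport (j, k, l, m), s i) +
      (if j = k then if l = m then M j j * M l l else 0 else 0) +
      (if j = l then if k = m then M j k ^ 2 else 0 else 0) +
      (if j = m then if k = l then M j k * M k j else 0 else 0) -
      2 * (if j = k then if j = l then if j = m then M j j ^ 2 else 0 else 0 else 0) := by
  by_cases h1 : j = k
  · subst h1
    by_cases h2 : l = m
    · subst h2
      have h3 : s j * s j * (s l * s l) = 1 := by rw [hs, hs, one_mul]
      rw [h3, hK.quadCoeff_self]
      by_cases h4 : j = l
      · subst h4; simp [offCoeff]; ring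
      · simp [offCoeff, h4]
    · rw [hK.quadCoeff_self]
      by_cases h4 : j = l
      · subst h4; simp [offCoeff, h2]
      · simp [offCoeff, h2, h4]
  by_cases h2 : j = l
  · subst h2
    rw [quadCoeff_swap_mid, hK.quadCoeff_self]
    by_cases h4 : k = m
    · subst h4
      have h3 : s j * s k * (s j * s k) = 1 := by
        rw [mul_mul_mul_comm, hs, hs, one_mul]
      rw [h3]; simp [offCoeff, h1]; ring
    · simp [offCoeff, h1, h4, Ne.symm h1]
  by_cases h3 : j = m
  · subst h3
    rw [quadCoeff_swap_right, quadCoeff_swap_mid, hK.quadCoeff_self]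
    by_cases h4 : k = l
    · subst h4
      have h3 : s j * s k * (s k * s j) = 1 := by
        rw [mul_comm (s k) (s j), mul_mul_mul_comm, hs, hs, one_mul]
      rw [h3]; simp [offCoeff, h1]
    · simp [offCoeff, h1, h2, h4, Ne.symm h1]
  by_cases h4 : k = l
  · subst h4
    rw [quadCoeff_swap_pairs, quadCoeff_swap_right, quadCoeff_swap_mid, hK.quadCoeff_self]
    simp [offCoeff, h1, Ne.symm h3, h3]
  by_cases h5 : k = m
  · subst h5
    rw [quadCoeff_swap_right, quadCoeff_swap_pairs, quadCoeff_swap_right, quadCoeff_swap_mid,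
      hK.quadCoeff_self]
    simp [offCoeff, h1, h2, Ne.symm h2]
  by_cases h6 : l = m
  · subst h6
    rw [quadCoeff_swap_pairs, hK.quadCoeff_self]
    simp [offCoeff, h1, h2]
  · have : ∏ i ∈ quadSupport (j, k, l, m), s i = s j * s k * (s l * s m) := by
      simp [quadSupport, h1, h2, h3, h4, h5, h6, mul_assoc]
    rw [this]
    simp [offCoeff, h1, h2, h3, h4, h5, h6]

theorem IsHadamard.sum_quadratic_sq (hK : IsHadamard K) (M : Matrix ι ι ℝ) (s : ι → ℝ)
    (hs : ∀ j, s j * s j = 1) :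
    (Fintype.card ι : ℝ)⁻¹ * ∑ i, (∑ j, ∑ k, K i j * K i k * M j k * (s j * s k)) ^ 2 =
      (M.trace ^ 2 + ∑ j, ∑ k, M j k ^ 2 + ∑ j, ∑ k, M j k * M k j) - 2 * ∑ j, M j j ^ 2 +
      ∑ x, offCoeff K M x * ∏ i ∈ quadSupport x, s i := by
  have h1 : (Fintype.card ι : ℝ)⁻¹ * ∑ i, (∑ j, ∑ k, K i j * K i k * M j k * (s j * s k)) ^ 2 =
      ∑ j, ∑ k, ∑ l, ∑ m, quadCoeff K j k l m * (M j k * M l m) * (s j * s k * (s l * s m)) := by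
    have : ∀ i, (∑ j, ∑ k, K i j * K i k * M j k * (s j * s k)) ^ 2 =
        ∑ j, ∑ k, ∑ l, ∑ m, K i j * K i k * K i l * K i m *
          ((M j k * M l m) * (s j * s k * (s l * s m))) := by
      intro i
      rw [sq, Finset.sum_mul]
      refine Finset.sum_congr rfl fun j _ => ?_
      rw [Finset.sum_mul]
      refine Finset.sum_congr rfl fun k _ => ?_
      rw [Finset.mul_sum]
      refine Finset.sum_congr rfl fun l _ => ?_
      rw [Finset.mul_sum]
      exact Finset.sum_congr rfl fun m _ => by ring
    simp_rw [this, quadCoeff]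
    rw [Finset.sum_comm, Finset.mul_sum]
    refine Finset.sum_congr rfl fun j _ => ?_
    rw [Finset.sum_comm, Finset.mul_sum]
    refine Finset.sum_congr rfl fun k _ => ?_
    rw [Finset.sum_comm, Finset.mul_sum]
    refine Finset.sum_congr rfl fun l _ => ?_
    rw [Finset.sum_comm, Finset.mul_sum]
    refine Finset.sum_congr rfl fun m _ => ?_
    rw [← Finset.sum_mul]
    ring
  have h2 : (∑ j, ∑ k, ∑ l, ∑ m, if j = k then if l = m then M j j * M l l else 0 else 0) =
      M.trace ^ 2 := by
    have (j : ι) : (∑ k, ∑ l, ∑ m, if j = k then if l = m then M j j * M l l else 0 else 0) =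
        ∑ l, M j j * M l l := by
      rw [Finset.sum_comm]
      refine Finset.sum_congr rfl fun l _ => ?_
      rw [Finset.sum_comm]
      simp
    simp_rw [this, ← Finset.mul_sum, ← Finset.sum_mul, sq, Matrix.trace, Matrix.diag]
  have h3 : (∑ j, ∑ k, ∑ l, ∑ m, if j = l then if k = m then M j k ^ 2 else 0 else 0) =
      ∑ j, ∑ k, M j k ^ 2 := by
    refine Finset.sum_congr rfl fun j _ => Finset.sum_congr rfl fun k _ => ?_
    rw [Finset.sum_comm]
    simp
  have h4 : (∑ j, ∑ k, ∑ l, ∑ m, if j = m then if k = l then M j k * M k j else 0 else 0) =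
      ∑ j, ∑ k, M j k * M k j := by
    refine Finset.sum_congr rfl fun j _ => Finset.sum_congr rfl fun k _ => ?_
    simp
  have h5 : (∑ j, ∑ k, ∑ l, ∑ m, if j = k then if j = l then if j = m then M j j ^ 2
      else 0 else 0 else 0) = ∑ j, M j j ^ 2 := by
    refine Finset.sum_congr rfl fun j _ => ?_
    rw [Finset.sum_eq_single j, Finset.sum_eq_single j, Finset.sum_eq_single j] <;>
      simp +contextual [eq_comm]
  rw [h1]
  simp_rw [hK.quadCoeff_mul_eq M s hs, Finset.sum_sub_distrib, Finset.sum_add_distrib,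
    ← Finset.mul_sum, h2, h3, h4, h5, Fintype.sum_prod_type]
  ring

/-- In the application `r j` is a multiple of a leverage score and `δ` bounds it. The first error
term is the diagonal correction, the second the `L²` norm of the off-diagonal Walsh polynomial. -/
theorem IsHadamard.integral_abs_sum_quadratic_sq_sub_le (hK : IsHadamard K) (M : Matrix ι ι ℝ)
    (r : ι → ℝ) (hr : ∀ j, 0 ≤ r j) (hM : ∀ j k, M j k ^ 2 ≤ r j * r k) (δ : ℝ)
    (hδ : ∀ j, r j ≤ δ) :
    ∫ ω, |(Fintype.card ι : ℝ)⁻¹ *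
        ∑ i, (∑ j, ∑ k, K i j * K i k * M j k * (sgn (ω j) * sgn (ω k))) ^ 2 -
      (M.trace ^ 2 + ∑ j, ∑ k, M j k ^ 2 + ∑ j, ∑ k, M j k * M k j)| ∂(coins ι half) ≤
      2 * (δ * ∑ j, r j) + Real.sqrt (256 * (δ * (∑ j, r j) ^ 3)) := by
  simp_rw [hK.sum_quadratic_sq M _ fun j => sgn_mul_self _]
  set R : (ι → Bool) → ℝ := fun ω => ∑ x, offCoeff K M x * ∏ i ∈ quadSupport x, sgn (ω i) with hR
  have hd : ∑ j, M j j ^ 2 ≤ δ * ∑ j, r j := by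
    rw [Finset.mul_sum]
    exact Finset.sum_le_sum fun j _ =>
      (hM j j).trans (mul_le_mul_of_nonneg_right (hδ j) (hr j))
  have hd0 : 0 ≤ ∑ j, M j j ^ 2 := Finset.sum_nonneg fun j _ => sq_nonneg _
  have hoff : ∑ x, offCoeff K M x ^ 2 ≤ δ * (∑ j, r j) ^ 3 := by
    -- Of the four factors `r`, the last is replaced by `δ`: the weight no longer depends on `m`,
    -- and Parseval sums out `m`.
    have h0 : ∀ j k l m, offCoeff K M (j, k, l, m) ^ 2 ≤
        (r j * r k * (r l * δ)) * quadCoeff K j k l m ^ 2 := by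
      intro j k l m
      have hnn : 0 ≤ (r j * r k * (r l * δ)) * quadCoeff K j k l m ^ 2 :=
        mul_nonneg (mul_nonneg (mul_nonneg (hr _) (hr _)) (mul_nonneg (hr _)
          ((hr l).trans (hδ l)))) (sq_nonneg _)
      unfold offCoeff
      split_ifs
      · rw [mul_pow, mul_pow, mul_comm]
        refine mul_le_mul_of_nonneg_right ?_ (sq_nonneg _)
        refine mul_le_mul (hM j k) ((hM l m).trans ?_) (sq_nonneg _) (mul_nonneg (hr _) (hr _))
        exact mul_le_mul_of_nonneg_left (hδ m) (hr l)
      · simpa using hnn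
    simp_rw [Fintype.sum_prod_type]
    calc _ ≤ ∑ j, ∑ k, ∑ l, ∑ m, (r j * r k * (r l * δ)) * quadCoeff K j k l m ^ 2 := by
          gcongr; exact h0 _ _ _ _
      _ = _ := by
        simp_rw [← Finset.mul_sum, hK.sum_quadCoeff_sq, mul_one, ← Finset.mul_sum,
          ← Finset.sum_mul, ← Finset.mul_sum, ← Finset.sum_mul]
        ring
  have hR2 : ∫ ω, R ω ^ 2 ∂(coins ι half) ≤ 256 * (δ * (∑ j, r j) ^ 3) :=
    (integral_sum_walsh_sq_le quadSupport (offCoeff K M) 256 card_quadSupport_eq_le).trans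
      (by push_cast; exact mul_le_mul_of_nonneg_left hoff (by norm_num))
  have hR1 : ∫ ω, |R ω| ∂(coins ι half) ≤ Real.sqrt (256 * (δ * (∑ j, r j) ^ 3)) := by
    refine Real.le_sqrt_of_sq_le (le_trans ?_ hR2)
    set c := ∫ ω, |R ω| ∂(coins ι half) with hc
    -- The variance of `|R|` is nonnegative, which gives `(E|R|)² ≤ E R²`.
    have h : 0 ≤ ∫ ω, (|R ω| - c) ^ 2 ∂(coins ι half) := integral_nonneg fun _ => sq_nonneg _
    have h' : ∫ ω, (|R ω| - c) ^ 2 ∂(coins ι half) =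
        ∫ ω, R ω ^ 2 ∂(coins ι half) - c ^ 2 := by
      simp_rw [sub_sq, sq_abs]
      rw [integral_add Integrable.of_finite Integrable.of_finite,
        integral_sub Integrable.of_finite Integrable.of_finite, integral_mul_const,
        integral_const_mul, ← hc]
      simp
      ring
    linarith
  calc _ ≤ ∫ ω, (2 * (δ * ∑ j, r j) + |R ω|) ∂(coins ι half) := by
        refine integral_mono Integrable.of_finite Integrable.of_finite fun ω => ?_
        have := abs_add_le (-(2 * ∑ j, M j j ^ 2)) (R ω)
        rw [abs_neg, abs_of_nonneg (by linarith : (0 : ℝ) ≤ 2 * ∑ j, M j j ^ 2)] at this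
        simp only
        refine le_trans (le_of_eq ?_) (this.trans (by linarith))
        congr 1
        ring
    _ ≤ _ := by
      rw [integral_add Integrable.of_finite Integrable.of_finite]
      simpa using hR1

end Chaos

/-! ### The characteristic function of a standardized Bernoulli variable -/

/-- For `|x| ≤ 1` this is the Taylor remainder; beyond that the triangle inequality suffices, and
the constant 4 leaves room for it. -/
theorem norm_cexp_sub_taylor_le (x : ℝ) :
    ‖Complex.exp (x * Complex.I) - (1 + x * Complex.I - (x : ℂ) ^ 2 / 2)‖ ≤ 4 * |x| ^ 3 := by
  have hn : ‖(x : ℂ) * Complex.I‖ = |x| := by simp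
  rcases le_or_gt |x| 1 with h | h
  · have := Complex.exp_bound (x := x * Complex.I) (by rw [hn]; exact h) (n := 3) (by norm_num)
    rw [hn] at this
    simp only [Finset.sum_range_succ, Finset.sum_range_zero] at this
    norm_num [Nat.factorial, mul_pow] at this
    have h3 : 0 ≤ |x| ^ 3 := by positivity
    refine le_trans (le_of_eq ?_) (this.trans (by linarith))
    congr 1
    ring
  · have h0 : (0 : ℝ) ≤ |x| := abs_nonneg x
    have h1 : ‖Complex.exp (x * Complex.I)‖ = 1 := Complex.norm_exp_ofReal_mul_I x
    have h2 : ‖(1 + x * Complex.I - (x : ℂ) ^ 2 / 2)‖ ≤ 1 + |x| + |x| ^ 2 / 2 := by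
      refine (norm_sub_le _ _).trans (add_le_add ((norm_add_le _ _).trans (by simp)) (by simp))
    refine (norm_sub_le _ _).trans ?_
    rw [h1]
    nlinarith [mul_pos (sub_pos.2 h) (sub_pos.2 h), pow_le_pow_left₀ zero_le_one h.le 2,
      mul_nonneg (sub_pos.2 h).le (sq_nonneg |x|)]

theorem abs_exp_neg_half_sq_sub_le (x : ℝ) :
    |Real.exp (-(x ^ 2 / 2)) - (1 - x ^ 2 / 2)| ≤ |x| ^ 3 := by
  have h0 : (0 : ℝ) ≤ |x| := abs_nonneg x
  have hx : x ^ 2 = |x| ^ 2 := (sq_abs x).symm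
  rw [hx]
  generalize |x| = u at h0
  rcases le_or_gt (u ^ 2 / 2) 1 with h | h
  · have := Real.norm_exp_sub_one_sub_id_le (x := -(u ^ 2 / 2))
      (by rw [norm_neg, Real.norm_of_nonneg (by positivity)]; exact h)
    rw [norm_neg, Real.norm_of_nonneg (by positivity : 0 ≤ u ^ 2 / 2), Real.norm_eq_abs] at this
    refine le_trans (le_of_eq ?_) (this.trans ?_)
    · congr 1; ring
    -- The remainder is `u⁴ / 4`, which is at most `u³` in this range.
    · have hu : u ≤ 2 := by nlinarith
      have : (u ^ 2 / 2) ^ 2 = u ^ 3 * (u / 4) := by ring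
      rw [this]
      exact mul_le_of_le_one_right (by positivity) (by linarith)
  · have h1 := Real.add_one_le_exp (-(u ^ 2 / 2))
    have h2 : Real.exp (-(u ^ 2 / 2)) ≤ 1 := Real.exp_le_one_iff.2 (by nlinarith)
    have hu : 1 ≤ u := by nlinarith
    rw [abs_of_nonneg (by linarith)]
    nlinarith [mul_le_mul_of_nonneg_right hu (sq_nonneg u)]

/-- The characteristic function of a standardized Bernoulli variable. -/
noncomputable def bernoulliCharFun (q y : ℝ) : ℂ :=
  q * Complex.exp (((1 - q) / Real.sqrt (q * (1 - q)) * y : ℝ) * Complex.I) +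
    (1 - q : ℝ) * Complex.exp (((0 - q) / Real.sqrt (q * (1 - q)) * y : ℝ) * Complex.I)

theorem norm_bernoulliCharFun_le {q : ℝ} (h0 : 0 ≤ q) (h1 : q ≤ 1) (y : ℝ) :
    ‖bernoulliCharFun q y‖ ≤ 1 := by
  refine (norm_add_le _ _).trans ?_
  rw [norm_mul, norm_mul, Complex.norm_exp_ofReal_mul_I, Complex.norm_exp_ofReal_mul_I,
    Complex.norm_real, Complex.norm_real, Real.norm_of_nonneg h0,
    Real.norm_of_nonneg (sub_nonneg.2 h1)]
  linarith

/-- The two values `a`, `b` have mean 0, variance 1 and third absolute moment at most `1/σ`. The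
expansions therefore agree to second order; the remainders cost `4/σ` for the Bernoulli side and `1
≤ 1/σ` for the Gaussian side. -/
theorem norm_bernoulliCharFun_sub_le {q : ℝ} (h0 : 0 < q) (h1 : q < 1) (y : ℝ) :
    ‖bernoulliCharFun q y - Complex.exp (-(y ^ 2 / 2 : ℝ))‖ ≤
      5 * (Real.sqrt (q * (1 - q)))⁻¹ * |y| ^ 3 := by
  set σ := Real.sqrt (q * (1 - q)) with hσ
  have h1' : 0 < 1 - q := sub_pos.2 h1
  have hσ0 : 0 < σ := Real.sqrt_pos.2 (mul_pos h0 h1')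
  have hσ2 : σ ^ 2 = q * (1 - q) := Real.sq_sqrt (mul_pos h0 h1').le
  have hσ1 : σ ≤ 1 := by nlinarith
  have hσ' : 1 ≤ σ⁻¹ := (one_le_inv₀ hσ0).2 hσ1
  set a := (1 - q) / σ with ha
  set b := (0 - q) / σ with hb
  have e1 : q * a + (1 - q) * b = 0 := by rw [ha, hb]; field_simp; ring
  have e2 : q * a ^ 2 + (1 - q) * b ^ 2 = 1 := by
    rw [ha, hb, div_pow, div_pow, hσ2]; field_simp; ring
  have e3 : q * |a| ^ 3 + (1 - q) * |b| ^ 3 ≤ σ⁻¹ := by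
    have hA : |a| = (1 - q) / σ := abs_of_pos (div_pos h1' hσ0)
    have hB : |b| = q / σ := by
      rw [hb, abs_div, abs_of_pos hσ0, zero_sub, abs_neg, abs_of_pos h0]
    have : q * |a| ^ 3 + (1 - q) * |b| ^ 3 = ((1 - q) ^ 2 + q ^ 2) * σ⁻¹ := by
      rw [hA, hB]
      have : σ ^ 3 = q * (1 - q) * σ := by rw [pow_succ, hσ2]
      rw [div_pow, div_pow, this]
      field_simp
    rw [this]
    exact mul_le_of_le_one_left (by positivity) (by nlinarith)
  have e1c : (q : ℂ) * a + (1 - q : ℝ) * b = 0 := by exact_mod_cast e1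
  have e2c : (q : ℂ) * a ^ 2 + (1 - q : ℝ) * b ^ 2 = 1 := by exact_mod_cast e2
  have ta := norm_cexp_sub_taylor_le (a * y)
  have tb := norm_cexp_sub_taylor_le (b * y)
  have tc := abs_exp_neg_half_sq_sub_le y
  set Ea := Complex.exp ((a * y : ℝ) * Complex.I) - (1 + (a * y : ℝ) * Complex.I -
    ((a * y : ℝ) : ℂ) ^ 2 / 2) with hEa
  set Eb := Complex.exp ((b * y : ℝ) * Complex.I) - (1 + (b * y : ℝ) * Complex.I -
    ((b * y : ℝ) : ℂ) ^ 2 / 2) with hEb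
  have key : bernoulliCharFun q y - Complex.exp (-(y ^ 2 / 2 : ℝ)) =
      q * Ea + (1 - q : ℝ) * Eb - ((Real.exp (-(y ^ 2 / 2)) - (1 - y ^ 2 / 2) : ℝ) : ℂ) := by
    rw [bernoulliCharFun, hEa, hEb, ← hσ, ← ha, ← hb]
    push_cast at e1c e2c ⊢
    linear_combination ((y : ℂ) * Complex.I) * e1c - ((y : ℂ) ^ 2 / 2) * e2c
  rw [key]
  refine (norm_sub_le _ _).trans ((add_le_add (norm_add_le _ _) le_rfl).trans ?_)
  rw [norm_mul, norm_mul, Complex.norm_real, Complex.norm_real, Complex.norm_real,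
    Real.norm_of_nonneg h0.le, Real.norm_of_nonneg h1'.le, Real.norm_eq_abs]
  have hy3 : 0 ≤ |y| ^ 3 := by positivity
  rw [abs_mul, mul_pow] at ta tb
  calc _ ≤ q * (4 * (|a| ^ 3 * |y| ^ 3)) + (1 - q) * (4 * (|b| ^ 3 * |y| ^ 3)) + |y| ^ 3 := by
        gcongr
    _ = 4 * (q * |a| ^ 3 + (1 - q) * |b| ^ 3) * |y| ^ 3 + 1 * |y| ^ 3 := by ring
    _ ≤ 4 * σ⁻¹ * |y| ^ 3 + σ⁻¹ * |y| ^ 3 := by gcongr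
    _ = _ := by ring

/-- Factors are exchanged one at a time, while the remaining ones stay bounded by 1. -/
theorem norm_prod_sub_prod_le {ι : Type*} (s : Finset ι) (f g : ι → ℂ) (hf : ∀ i, ‖f i‖ ≤ 1)
    (hg : ∀ i, ‖g i‖ ≤ 1) : ‖∏ i ∈ s, f i - ∏ i ∈ s, g i‖ ≤ ∑ i ∈ s, ‖f i - g i‖ := by
  classical
  induction s using Finset.induction_on with
  | empty => simp
  | insert a s ha ih =>
    rw [Finset.prod_insert ha, Finset.prod_insert ha, Finset.sum_insert ha]
    have h1 : ‖∏ i ∈ s, f i‖ ≤ 1 := by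
      rw [norm_prod]; exact Finset.prod_le_one (fun _ _ => norm_nonneg _) fun i _ => hf i
    have : f a * ∏ i ∈ s, f i - g a * ∏ i ∈ s, g i =
        (f a - g a) * ∏ i ∈ s, f i + g a * (∏ i ∈ s, f i - ∏ i ∈ s, g i) := by ring
    rw [this]
    refine (norm_add_le _ _).trans (add_le_add ?_ ?_)
    · rw [norm_mul]; exact mul_le_of_le_one_right (norm_nonneg _) h1
    · rw [norm_mul]; exact (mul_le_of_le_one_left (norm_nonneg _) (hg a)).trans ih

theorem abs_exp_neg_sub_exp_neg_le {a b : ℝ} (ha : 0 ≤ a) (hb : 0 ≤ b) :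
    |Real.exp (-a) - Real.exp (-b)| ≤ |a - b| := by
  wlog h : a ≤ b generalizing a b
  · rw [abs_sub_comm, abs_sub_comm a]
    exact this hb ha (le_of_not_ge h)
  rw [abs_of_nonneg (sub_nonneg.2 (Real.exp_le_exp.2 (neg_le_neg h))), abs_sub_comm,
    abs_of_nonneg (sub_nonneg.2 h)]
  have h1 := Real.add_one_le_exp (-(b - a))
  have h2 : Real.exp (-b) = Real.exp (-a) * Real.exp (-(b - a)) := by
    rw [← Real.exp_add]; congr 1; ring
  have h3 : Real.exp (-a) ≤ 1 := Real.exp_le_one_iff.2 (by linarith)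
  have h4 := Real.exp_pos (-a)
  rw [h2]
  nlinarith

/-- Lindeberg replacement for each fixed `ω`: Gaussian factors are substituted for the Bernoulli
ones, and then the random variance `∑ y²` is exchanged for `g`, the exponential being 1-Lipschitz on
the negative half-line. -/
theorem norm_integral_prod_bernoulliCharFun_sub_le {Ω ι : Type*} [Finite Ω] [MeasurableSpace Ω]
    [MeasurableSingletonClass Ω] [Fintype ι] (μ : Measure Ω) [IsProbabilityMeasure μ]
    {q : ℝ} (h0 : 0 < q) (h1 : q < 1) (y : Ω → ι → ℝ) {g : ℝ} (hg : 0 ≤ g) :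
    ‖∫ ω, ∏ i, bernoulliCharFun q (y ω i) ∂μ - Complex.exp (-(g / 2 : ℝ))‖ ≤
      5 * (Real.sqrt (q * (1 - q)))⁻¹ * ∑ i, ∫ ω, |y ω i| ^ 3 ∂μ +
        (1 / 2) * ∫ ω, |∑ i, y ω i ^ 2 - g| ∂μ := by
  have hc : Complex.exp (-(g / 2 : ℝ)) = ∫ _, Complex.exp (-(g / 2 : ℝ)) ∂μ := by simp
  rw [hc, ← integral_sub Integrable.of_finite Integrable.of_finite]
  refine (norm_integral_le_integral_norm _).trans ?_
  rw [← integral_finsetSum _ fun _ _ => Integrable.of_finite, ← integral_const_mul,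
    ← integral_const_mul, ← integral_add Integrable.of_finite Integrable.of_finite]
  refine integral_mono Integrable.of_finite Integrable.of_finite fun ω => ?_
  have hA := norm_prod_sub_prod_le Finset.univ (fun i => bernoulliCharFun q (y ω i))
    (fun i => Complex.exp (-(y ω i ^ 2 / 2 : ℝ))) (fun i => norm_bernoulliCharFun_le h0.le h1.le _)
    (fun i => by
      rw [← Complex.ofReal_neg, ← Complex.ofReal_exp, Complex.norm_real,
        Real.norm_of_nonneg (Real.exp_pos _).le]
      exact Real.exp_le_one_iff.2 (by nlinarith [sq_nonneg (y ω i)]))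
  have hA' := hA.trans (Finset.sum_le_sum fun i _ => norm_bernoulliCharFun_sub_le h0 h1 (y ω i))
  rw [← Finset.mul_sum] at hA'
  have hB : ‖∏ i, Complex.exp (-(y ω i ^ 2 / 2 : ℝ)) - Complex.exp (-(g / 2 : ℝ))‖ ≤
      1 / 2 * |∑ i, y ω i ^ 2 - g| := by
    rw [← Complex.exp_sum, Finset.sum_neg_distrib, ← Complex.ofReal_sum, ← Complex.ofReal_neg,
      ← Complex.ofReal_neg, ← Complex.ofReal_exp, ← Complex.ofReal_exp, ← Complex.ofReal_sub,
      Complex.norm_real, Real.norm_eq_abs]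
    refine (abs_exp_neg_sub_exp_neg_le (Finset.sum_nonneg fun i _ => by positivity)
      (by positivity)).trans (le_of_eq ?_)
    rw [← Finset.sum_div, ← sub_div, abs_div, abs_two]
    ring
  exact (norm_sub_le_norm_sub_add_norm_sub _ _ _).trans (add_le_add hA' hB)

/-! ### Quadratic forms in the rows of the randomized matrix -/

section Rows

variable {ι : Type*} [Fintype ι] {p : ℕ}

/-- The entries of `K * diag(sgn ω) * V`. -/
def randomizedEntry (K : Matrix ι ι ℝ) (V : Matrix ι (Fin p) ℝ) (ω : ι → Bool) (i : ι)
    (a : Fin p) : ℝ :=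
  ∑ j, K i j * V j a * sgn (ω j)

/-- The quadratic form of `T` at the `i`-th row of the randomized matrix, normalized. -/
noncomputable def rowForm (K : Matrix ι ι ℝ) (V : Matrix ι (Fin p) ℝ)
    (T : Matrix (Fin p) (Fin p) ℝ) (ω : ι → Bool) (i : ι) : ℝ :=
  (Real.sqrt (Fintype.card ι))⁻¹ *
    ∑ a, ∑ b, T a b * (randomizedEntry K V ω i a * randomizedEntry K V ω i b)

/-- The variance of the limit in direction `T`. -/
def limitForm (T : Matrix (Fin p) (Fin p) ℝ) : ℝ :=
  T.trace ^ 2 + ∑ a, ∑ b, T a b ^ 2 + ∑ a, ∑ b, T a b * T b a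

/-- The sum of the absolute values of the entries. -/
def absSum (T : Matrix (Fin p) (Fin p) ℝ) : ℝ := ∑ a, ∑ b, |T a b|

theorem absSum_nonneg (T : Matrix (Fin p) (Fin p) ℝ) : 0 ≤ absSum T :=
  Finset.sum_nonneg fun _ _ => Finset.sum_nonneg fun _ _ => abs_nonneg _

theorem abs_sum_mul_le (T : Matrix (Fin p) (Fin p) ℝ) (x y : Fin p → ℝ) :
    |∑ a, ∑ b, T a b * (x a * y b)| ≤
      absSum T * (Real.sqrt (∑ a, x a ^ 2) * Real.sqrt (∑ a, y a ^ 2)) := by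
  have h : ∀ (z : Fin p → ℝ) a, |z a| ≤ Real.sqrt (∑ a, z a ^ 2) := fun z a =>
    Real.abs_le_sqrt (Finset.single_le_sum (f := fun a => z a ^ 2) (fun _ _ => sq_nonneg _)
      (Finset.mem_univ a))
  unfold absSum
  rw [Finset.sum_mul]
  refine (Finset.abs_sum_le_sum_abs _ _).trans (Finset.sum_le_sum fun a _ => ?_)
  rw [Finset.sum_mul]
  refine (Finset.abs_sum_le_sum_abs _ _).trans (Finset.sum_le_sum fun b _ => ?_)
  rw [abs_mul, abs_mul]
  exact mul_le_mul_of_nonneg_left (mul_le_mul (h x a) (h y b) (abs_nonneg _)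
    (Real.sqrt_nonneg _)) (abs_nonneg _)

theorem sum_sq_eq_trace {κ : Type*} [Fintype κ] (A : Matrix κ κ ℝ) :
    ∑ j, ∑ k, A j k ^ 2 = (A * A.transpose).trace := by
  simp [Matrix.trace, Matrix.mul_apply, sq]

theorem sum_mul_swap_eq_trace {κ : Type*} [Fintype κ] (A : Matrix κ κ ℝ) :
    ∑ j, ∑ k, A j k * A k j = (A * A).trace := by
  simp [Matrix.trace, Matrix.mul_apply]

/-- All three terms are built from traces of `T`, `T * Tᵀ` and `T * T`, and orthonormal columns make
`V * · * Vᵀ` multiplicative and trace preserving. -/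
theorem limitForm_conj (V : Matrix ι (Fin p) ℝ) (hV : V.transpose * V = 1)
    (T : Matrix (Fin p) (Fin p) ℝ) :
    (V * T * V.transpose).trace ^ 2 + ∑ j, ∑ k, (V * T * V.transpose) j k ^ 2 +
      ∑ j, ∑ k, (V * T * V.transpose) j k * (V * T * V.transpose) k j = limitForm T := by
  have h : ∀ A : Matrix (Fin p) (Fin p) ℝ, (V * A * V.transpose).trace = A.trace := fun A => by
    rw [Matrix.trace_mul_comm, ← Matrix.mul_assoc, hV, Matrix.one_mul]
  have h2 : ∀ A B : Matrix (Fin p) (Fin p) ℝ,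
      V * A * V.transpose * (V * B * V.transpose) = V * (A * B) * V.transpose := fun A B => by
    calc _ = V * A * (V.transpose * V) * B * V.transpose := by simp only [Matrix.mul_assoc]
      _ = _ := by rw [hV]; simp only [Matrix.mul_assoc, Matrix.one_mul]
  have h3 : (V * T * V.transpose).transpose = V * T.transpose * V.transpose := by
    simp [Matrix.mul_assoc]
  rw [limitForm, sum_sq_eq_trace, sum_sq_eq_trace, sum_mul_swap_eq_trace, sum_mul_swap_eq_trace,
    h3, h2, h2, h, h, h]

theorem conj_apply {κ : Type*} (V : Matrix κ (Fin p) ℝ) (T : Matrix (Fin p) (Fin p) ℝ) (j k : κ) :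
    (V * T * V.transpose) j k = ∑ a, ∑ b, T a b * (V j a * V k b) := by
  simp only [Matrix.mul_apply, Matrix.transpose_apply, Finset.sum_mul]
  rw [Finset.sum_comm]
  exact Finset.sum_congr rfl fun a _ => Finset.sum_congr rfl fun b _ => by ring

theorem rowForm_eq (K : Matrix ι ι ℝ) (V : Matrix ι (Fin p) ℝ)
    (T : Matrix (Fin p) (Fin p) ℝ) (ω : ι → Bool) (i : ι) :
    rowForm K V T ω i = (Real.sqrt (Fintype.card ι))⁻¹ *
      ∑ j, ∑ k, K i j * K i k * (V * T * V.transpose) j k * (sgn (ω j) * sgn (ω k)) := by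
  unfold rowForm
  congr 1
  simp_rw [conj_apply, randomizedEntry, Finset.sum_mul_sum, Finset.mul_sum, Finset.sum_mul]
  calc _ = ∑ a, ∑ j, ∑ b, ∑ k, T a b * (K i j * V j a * sgn (ω j) * (K i k * V k b * sgn (ω k))) :=
        Finset.sum_congr rfl fun a _ => Finset.sum_comm
    _ = ∑ j, ∑ a, ∑ b, ∑ k, T a b * (K i j * V j a * sgn (ω j) * (K i k * V k b * sgn (ω k))) :=
        Finset.sum_comm
    _ = _ := by
      refine Finset.sum_congr rfl fun j _ => ?_
      have : ∀ f : Fin p → Fin p → ι → ℝ, ∑ a, ∑ b, ∑ k, f a b k = ∑ k, ∑ a, ∑ b, f a b k := by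
        intro f
        exact (Finset.sum_congr rfl fun a _ => Finset.sum_comm).trans Finset.sum_comm
      rw [this]
      exact Finset.sum_congr rfl fun k _ => Finset.sum_congr rfl fun a _ =>
        Finset.sum_congr rfl fun b _ => by ring

theorem sum_col_sq (V : Matrix ι (Fin p) ℝ) (hV : V.transpose * V = 1) (a : Fin p) :
    ∑ j, V j a ^ 2 = 1 := by
  have := congrFun (congrFun hV a) a
  simpa [Matrix.mul_apply, sq] using this

variable [DecidableEq ι] [Nonempty ι] {K : Matrix ι ι ℝ}

theorem IsHadamard.integral_abs_rowForm_pow_three_le (hK : IsHadamard K) (V : Matrix ι (Fin p) ℝ)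
    (hV : V.transpose * V = 1) (T : Matrix (Fin p) (Fin p) ℝ) (i : ι) :
    ∫ ω, |rowForm K V T ω i| ^ 3 ∂(coins ι half) ≤
      (Real.sqrt (Fintype.card ι))⁻¹ ^ 3 *
        (absSum T ^ 3 * (p ^ 2 * (p * (720 * Real.exp (1 / 2))))) := by
  have hpt : ∀ ω, |rowForm K V T ω i| ^ 3 ≤ (Real.sqrt (Fintype.card ι))⁻¹ ^ 3 *
      (absSum T ^ 3 * (p ^ 2 * ∑ a, randomizedEntry K V ω i a ^ 6)) := by
    intro ω
    set x := randomizedEntry K V ω i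
    have h0 : 0 ≤ ∑ a, x a ^ 2 := Finset.sum_nonneg fun _ _ => sq_nonneg _
    have h1 := abs_sum_mul_le T x x
    rw [Real.mul_self_sqrt h0] at h1
    -- The power mean inequality reduces to sixth moments of single entries, to which Khintchine's
    -- inequality applies.
    have h2 : (∑ a, x a ^ 2) ^ 3 ≤ (p : ℝ) ^ 2 * ∑ a, x a ^ 6 := by
      have := pow_sum_div_card_le_sum_pow (s := Finset.univ) (f := fun a => x a ^ 2)
        (fun _ _ => sq_nonneg _) 2
      simp_rw [← pow_mul] at this
      norm_num at this
      rcases Nat.eq_zero_or_pos p with hp | hp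
      · subst hp; simp
      · rwa [div_le_iff₀ (by positivity), mul_comm] at this
    unfold rowForm
    rw [abs_mul, mul_pow, abs_of_nonneg (inv_nonneg.2 (Real.sqrt_nonneg _))]
    refine mul_le_mul_of_nonneg_left ?_ (by positivity)
    calc _ ≤ (absSum T * ∑ a, x a ^ 2) ^ 3 := pow_le_pow_left₀ (abs_nonneg _) h1 3
      _ = absSum T ^ 3 * (∑ a, x a ^ 2) ^ 3 := mul_pow _ _ _
      _ ≤ _ := mul_le_mul_of_nonneg_left h2 (pow_nonneg (absSum_nonneg T) 3)
  refine (integral_mono Integrable.of_finite Integrable.of_finite hpt).trans ?_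
  rw [integral_const_mul, integral_const_mul, integral_const_mul,
    integral_finsetSum _ fun _ _ => Integrable.of_finite]
  have h6 : ∀ a, ∫ ω, randomizedEntry K V ω i a ^ 6 ∂(coins ι half) ≤ 720 * Real.exp (1 / 2) :=
    fun a => integral_sum_sgn_pow_six_le _ (by
      simp_rw [mul_pow, hK.sq_apply, one_mul, sum_col_sq V hV])
  have h7 := Finset.sum_le_sum fun a (_ : a ∈ Finset.univ) => h6 a
  rw [Finset.sum_const, Finset.card_univ, Fintype.card_fin, nsmul_eq_mul] at h7
  have := absSum_nonneg T
  gcongr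

theorem IsHadamard.integral_abs_sum_rowForm_sq_sub_le (hK : IsHadamard K) (V : Matrix ι (Fin p) ℝ)
    (hV : V.transpose * V = 1) (T : Matrix (Fin p) (Fin p) ℝ) (ε : ℝ)
    (hε : ∀ j, ∑ a, V j a ^ 2 ≤ ε) :
    ∫ ω, |∑ i, rowForm K V T ω i ^ 2 - limitForm T| ∂(coins ι half) ≤
      2 * (absSum T * ε * (absSum T * p)) +
        Real.sqrt (256 * (absSum T * ε * (absSum T * p) ^ 3)) := by
  have hτ := absSum_nonneg T
  -- The leverage scores add up to `p`, so the total mass stays bounded while the maximum tends to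
  -- zero.
  have hsum : ∑ j, absSum T * ∑ a, V j a ^ 2 = absSum T * p := by
    rw [← Finset.mul_sum, Finset.sum_comm]
    simp_rw [sum_col_sq V hV]
    simp
  have hnn : ∀ j, 0 ≤ ∑ a, V j a ^ 2 := fun j => Finset.sum_nonneg fun _ _ => sq_nonneg _
  have main := hK.integral_abs_sum_quadratic_sq_sub_le (V * T * V.transpose)
    (fun j => absSum T * ∑ a, V j a ^ 2) (fun j => mul_nonneg hτ (hnn j))
    (fun j k => by
      rw [conj_apply, ← sq_abs]
      refine (pow_le_pow_left₀ (abs_nonneg _) (abs_sum_mul_le T (V j) (V k)) 2).trans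
        (le_of_eq ?_)
      rw [mul_pow, mul_pow, Real.sq_sqrt (hnn j), Real.sq_sqrt (hnn k)]
      ring) (absSum T * ε) (fun j => mul_le_mul_of_nonneg_left (hε j) hτ)
  rw [hsum] at main
  refine le_trans (le_of_eq ?_) main
  refine integral_congr_ae (Filter.Eventually.of_forall fun ω => ?_)
  simp only
  rw [limitForm_conj V hV]
  congr 2
  simp_rw [rowForm_eq, mul_pow, inv_pow, Real.sq_sqrt (Nat.cast_nonneg _)]
  rw [← Finset.mul_sum]

theorem IsHadamard.norm_integral_prod_bernoulliCharFun_rowForm_sub_le (hK : IsHadamard K)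
    (V : Matrix ι (Fin p) ℝ) (hV : V.transpose * V = 1) (T : Matrix (Fin p) (Fin p) ℝ) (ε : ℝ)
    (hε : ∀ j, ∑ a, V j a ^ 2 ≤ ε) {q : ℝ} (h0 : 0 < q) (h1 : q < 1) (hT : 0 ≤ limitForm T) :
    ‖∫ ω, ∏ i, bernoulliCharFun q (rowForm K V T ω i) ∂(coins ι half) -
        Complex.exp (-(limitForm T / 2 : ℝ))‖ ≤
      5 * (absSum T ^ 3 * (p ^ 2 * (p * (720 * Real.exp (1 / 2))))) *
          (Real.sqrt (Fintype.card ι * (q * (1 - q))))⁻¹ +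
        (1 / 2) * (2 * (absSum T * ε * (absSum T * p)) +
        Real.sqrt (256 * (absSum T * ε * (absSum T * p) ^ 3))) := by
  refine (norm_integral_prod_bernoulliCharFun_sub_le (coins ι half) h0 h1
    (fun ω i => rowForm K V T ω i) hT).trans ?_
  refine add_le_add ?_ (mul_le_mul_of_nonneg_left
    (hK.integral_abs_sum_rowForm_sq_sub_le V hV T ε hε) (by norm_num))
  have hs := Finset.sum_le_sum fun i (_ : i ∈ Finset.univ) =>
    hK.integral_abs_rowForm_pow_three_le V hV T i
  rw [Finset.sum_const, Finset.card_univ, nsmul_eq_mul] at hs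
  refine (mul_le_mul_of_nonneg_left hs (by positivity)).trans (le_of_eq ?_)
  have hN : (0 : ℝ) < Fintype.card ι := by exact_mod_cast Fintype.card_pos
  rw [Real.sqrt_mul hN.le, mul_inv]
  have hsN : Real.sqrt (Fintype.card ι) ≠ 0 := (Real.sqrt_pos.2 hN).ne'
  -- `N` rows, each contributing `N^(-3/2)`.
  have : (Fintype.card ι : ℝ) * (Real.sqrt (Fintype.card ι))⁻¹ ^ 3 =
      (Real.sqrt (Fintype.card ι))⁻¹ := by
    nth_rewrite 1 [← Real.mul_self_sqrt hN.le]
    field_simp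
  linear_combination (5 * (√(q * (1 - q)))⁻¹ *
    (absSum T ^ 3 * (p ^ 2 * (p * (720 * Real.exp (1 / 2)))))) * this

end Rows

/-! ### Reduction to coins -/

/-- The Bernoulli variable of a coin. -/
def bit (b : Bool) : ℝ := if b then 1 else 0

theorem bit_mul_self (b : Bool) : bit b * bit b = bit b := by cases b <;> simp [bit]

/-- The SRHT matrix as a function of the Bernoulli and Rademacher variables. -/
noncomputable def srhtMatrix (m n : ℕ) (x : Fin (2 ^ exponent n) ⊕ Fin (2 ^ exponent n) → ℝ) :
    Matrix (Fin (2 ^ exponent n)) (Fin n) ℝ :=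
  Real.sqrt ((2 : ℝ) ^ exponent n / m) •
    (Matrix.diagonal (fun i => x (Sum.inl i)) * hadamardMatrix (exponent n) *
      Matrix.diagonal (fun i => x (Sum.inr i)) * paddingMatrix (2 ^ exponent n) n)

theorem continuous_quadForm_srhtMatrix {p : ℕ} (m n : ℕ) (U : Matrix (Fin n) (Fin p) ℝ) :
    Continuous fun x => quadForm m U (srhtMatrix m n x) := by
  have h : Continuous (srhtMatrix m n) := by
    have h1 : Continuous fun x : Fin (2 ^ exponent n) ⊕ Fin (2 ^ exponent n) → ℝ =>
        Matrix.diagonal fun i => x (Sum.inl i) :=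
      Continuous.matrix_diagonal (continuous_pi fun i => continuous_apply _)
    have h2 : Continuous fun x : Fin (2 ^ exponent n) ⊕ Fin (2 ^ exponent n) → ℝ =>
        Matrix.diagonal fun i => x (Sum.inr i) :=
      Continuous.matrix_diagonal (continuous_pi fun i => continuous_apply _)
    exact (((h1.matrix_mul (continuous_const (y := hadamardMatrix (exponent n)))).matrix_mul
      h2).matrix_mul (continuous_const (y := paddingMatrix (2 ^ exponent n) n))).const_smul
      (Real.sqrt ((2 : ℝ) ^ exponent n / m))
  have h2 : Continuous fun x => U.transpose * (srhtMatrix m n x).transpose * srhtMatrix m n x * U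
      - 1 :=
    ((((continuous_const (y := U.transpose)).matrix_mul h.matrix_transpose).matrix_mul h).matrix_mul
      (continuous_const (y := U))).sub continuous_const
  have h3 : Continuous fun x => vec (U.transpose * (srhtMatrix m n x).transpose *
      srhtMatrix m n x * U - 1) :=
    continuous_pi fun ij => (continuous_apply ij.2).comp ((continuous_apply ij.1).comp h2)
  exact ((PiLp.continuous_toLp 2 _).comp h3).const_smul (Real.sqrt ((m : ℝ) / (1 - rate m n)))

/-- Moves the problem to a finite space, where integrability and measurability are automatic. The
signs form the first factor, so that Fubini integrates out the sampling for fixed signs. -/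
theorem map_bernoulli_rademacher {Ω ι : Type*} [Fintype ι] [MeasurableSpace Ω] (P : Measure Ω)
    [IsProbabilityMeasure P] (q : unitInterval) (B D : ι → Ω → ℝ) (hi : iIndepFun (Sum.elim B D) P)
    (hB : ∀ i, HasLaw (B i) (bernoulliLaw q) P) (hD : ∀ i, HasLaw (D i) rademacherLaw P) :
    P.map (fun ω i => Sum.elim B D i ω) = ((coins ι half).prod (coins ι q)).map
      (fun x => Sum.elim (fun i => bit (x.2 i)) (fun i => sgn (x.1 i))) := by
  have hm : ∀ i, AEMeasurable (Sum.elim B D i) P := by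
    rintro (i | i)
    · exact (hB i).aemeasurable
    · exact (hD i).aemeasurable
  have hb : bernoulliLaw q = (bernoulliMeasure true false q).map bit := by
    rw [map_bernoulliMeasure]; simp [bit, bernoulliLaw]
  have hr : rademacherLaw = (bernoulliMeasure true false half).map sgn := by
    rw [map_bernoulliMeasure]; simp [sgn, rademacherLaw, half]
  have hbm : Measurable bit := measurable_of_finite _
  have hsm : Measurable sgn := measurable_of_finite _
  rw [hi.map_fun_eq_pi_map hm]
  refine Measure.pi_eq fun s hs => ?_
  rw [Measure.map_apply (measurable_of_finite _) (MeasurableSet.univ_pi hs)]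
  have : (fun x : (ι → Bool) × (ι → Bool) =>
      (Sum.elim (fun i => bit (x.2 i)) (fun i => sgn (x.1 i)) : ι ⊕ ι → ℝ)) ⁻¹' Set.univ.pi s =
      (Set.univ.pi fun i => sgn ⁻¹' s (Sum.inr i)) ×ˢ
        (Set.univ.pi fun i => bit ⁻¹' s (Sum.inl i)) := by
    ext x
    simp only [Set.mem_preimage, Set.mem_univ_pi, Set.mem_prod, Sum.forall, Sum.elim_inl,
      Sum.elim_inr]
    exact and_comm
  rw [this, Measure.prod_prod, coins, coins, Measure.pi_pi, Measure.pi_pi, Fintype.prod_sum_type,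
    mul_comm]
  congr 1
  · refine Finset.prod_congr rfl fun i _ => ?_
    rw [Sum.elim_inl, (hB i).map_eq, hb, Measure.map_apply hbm (hs _)]
  · refine Finset.prod_congr rfl fun i _ => ?_
    rw [Sum.elim_inr, (hD i).map_eq, hr, Measure.map_apply hsm (hs _)]

/-! ### Padding -/

theorem paddingMatrix_transpose_mul_self {N n : ℕ} (h : n ≤ N) :
    (paddingMatrix N n).transpose * paddingMatrix N n = 1 := by
  ext i j
  rw [Matrix.mul_apply, Finset.sum_eq_single (Fin.castLE h i)]
  · simp [paddingMatrix, Matrix.one_apply, Fin.ext_iff]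
  · intro k _ hk
    have : (k : ℕ) ≠ i := fun h => hk (Fin.ext h)
    simp [paddingMatrix, this]
  · simp

theorem sum_padding_mul_sq_le {N n p : ℕ} (U : Matrix (Fin n) (Fin p) ℝ) (j : Fin N) :
    ∑ a, (paddingMatrix N n * U) j a ^ 2 ≤ maxRowNorm U ^ 2 := by
  by_cases hj : (j : ℕ) < n
  · have h1 : ∀ a, (paddingMatrix N n * U) j a = U ⟨j, hj⟩ a := by
      intro a
      rw [Matrix.mul_apply, Finset.sum_eq_single ⟨j, hj⟩]
      · simp [paddingMatrix]
      · intro k _ hk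
        have : (j : ℕ) ≠ k := fun h => hk (Fin.ext h.symm)
        simp [paddingMatrix, this]
      · simp
    have h2 : ‖WithLp.toLp 2 (U ⟨j, hj⟩)‖ ≤ maxRowNorm U :=
      le_ciSup (f := fun i => ‖WithLp.toLp 2 (U i)‖) (Set.finite_range _).bddAbove ⟨j, hj⟩
    have h3 := pow_le_pow_left₀ (norm_nonneg _) h2 2
    rw [EuclideanSpace.real_norm_sq_eq] at h3
    simpa [h1] using h3
  · have h1 : ∀ a, (paddingMatrix N n * U) j a = 0 := by
      intro a
      rw [Matrix.mul_apply]
      refine Finset.sum_eq_zero fun k _ => ?_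
      have : (j : ℕ) ≠ k := fun h => hj (h ▸ k.2)
      simp [paddingMatrix, this]
    simp [h1, sq_nonneg]

theorem padding_mul_transpose_mul_self {n p : ℕ} (U : Matrix (Fin n) (Fin p) ℝ)
    (hU : U.transpose * U = 1) :
    (paddingMatrix (2 ^ exponent n) n * U).transpose * (paddingMatrix (2 ^ exponent n) n * U) =
      1 := by
  have h := paddingMatrix_transpose_mul_self (Nat.le_pow_clog one_lt_two n)
  rw [Matrix.transpose_mul, Matrix.mul_assoc, ← Matrix.mul_assoc _ (paddingMatrix _ n)]
  erw [h]
  rw [Matrix.one_mul, hU]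

/-- The unnormalized Hadamard matrix. -/
noncomputable def signMatrix (t : ℕ) : Matrix (Fin (2 ^ t)) (Fin (2 ^ t)) ℝ :=
  Real.sqrt (2 ^ t) • hadamardMatrix t

theorem isHadamard_signMatrix (t : ℕ) : IsHadamard (signMatrix t) where
  sq_apply i j := by
    rw [signMatrix, Matrix.smul_apply, smul_eq_mul, mul_pow, hadamardMatrix_sq,
      Real.sq_sqrt (by positivity)]
    field_simp
  transpose_mul_self := by
    rw [signMatrix, Matrix.transpose_smul, Matrix.smul_mul, Matrix.mul_smul, smul_smul,
      hadamardMatrix_transpose_mul_self, Real.mul_self_sqrt (by positivity)]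
    simp

/-! ### The quadratic form in terms of coins -/

/-- With `m = q * N`, the normalization of the theorem splits into a standardized Bernoulli value
and the factor `1 / √N` of `rowForm`. -/
theorem scale_identity {q N b : ℝ} (hq0 : 0 < q) (hq1 : q < 1) (hN : 0 < N) :
    Real.sqrt (q * N / (1 - q)) * ((b / q - 1) * N⁻¹) =
      (b - q) / Real.sqrt (q * (1 - q)) * (Real.sqrt N)⁻¹ := by
  have h1 : 0 < 1 - q := sub_pos.2 hq1
  rw [Real.sqrt_div (by positivity), Real.sqrt_mul hq0.le, Real.sqrt_mul hq0.le]
  have e1 : Real.sqrt q * Real.sqrt q = q := Real.mul_self_sqrt hq0.le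
  have e2 : Real.sqrt N * Real.sqrt N = N := Real.mul_self_sqrt hN.le
  have p1 : 0 < Real.sqrt q := Real.sqrt_pos.2 hq0
  have p2 : 0 < Real.sqrt N := Real.sqrt_pos.2 hN
  have p3 : 0 < Real.sqrt (1 - q) := Real.sqrt_pos.2 h1
  have : (b / q - 1) * N⁻¹ = (b - q) / (Real.sqrt q * Real.sqrt q) *
      (Real.sqrt N * Real.sqrt N)⁻¹ := by
    rw [e1, e2]; field_simp
  rw [this]
  field_simp

theorem inner_quadForm_srhtMatrix {p : ℕ} {m n : ℕ} (U : Matrix (Fin n) (Fin p) ℝ)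
    (hU : U.transpose * U = 1) (hm : 0 < m) (hr : rate m n < 1)
    (β : Fin (2 ^ exponent n) → ℝ) (hβ : ∀ i, β i * β i = β i)
    (ε : Fin (2 ^ exponent n) → Bool) (t : EuclideanSpace ℝ (Fin p × Fin p)) :
    inner ℝ (quadForm m U (srhtMatrix m n (Sum.elim β fun i => sgn (ε i)))) t =
      ∑ i, (β i - rate m n) / Real.sqrt (rate m n * (1 - rate m n)) *
        rowForm (signMatrix (exponent n)) (paddingMatrix (2 ^ exponent n) n * U)
          (Matrix.of fun a b => t (a, b)) ε i := by
  obtain ⟨N, hN⟩ : ∃ N : ℝ, N = 2 ^ exponent n := ⟨_, rfl⟩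
  have hN0 : 0 < N := by rw [hN]; positivity
  obtain ⟨V, hV⟩ : ∃ V, V = paddingMatrix (2 ^ exponent n) n * U := ⟨_, rfl⟩
  have hVV : V.transpose * V = 1 := by
    rw [hV]; exact padding_mul_transpose_mul_self U hU
  have hr0 : 0 < rate m n := by
    unfold rate; have : (0 : ℝ) < m := by exact_mod_cast hm
    positivity
  have hrm : (m : ℝ) = rate m n * N := by
    rw [rate, ← hN]; field_simp
  obtain ⟨Δ, hΔ⟩ : ∃ Δ, Δ = Matrix.diagonal (fun i => sgn (ε i)) := ⟨_, rfl⟩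
  obtain ⟨W, hW⟩ : ∃ W, W = hadamardMatrix (exponent n) * Δ * V := ⟨_, rfl⟩
  have hX : ∀ i a, W i a = (Real.sqrt N)⁻¹ * randomizedEntry (signMatrix (exponent n)) V ε i a := by
    intro i a
    rw [hW, hΔ, Matrix.mul_apply, randomizedEntry, Finset.mul_sum]
    refine Finset.sum_congr rfl fun j _ => ?_
    rw [Matrix.mul_diagonal, signMatrix, Matrix.smul_apply, smul_eq_mul, ← hN]
    have := (Real.sqrt_pos.2 hN0).ne'
    field_simp
  have hΔ2 : Δ * Δ = 1 := by
    rw [hΔ, Matrix.diagonal_mul_diagonal]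
    simp_rw [sgn_mul_self]
    exact Matrix.diagonal_one
  -- Writing the subtracted identity as `Wᵀ W` centres the form row by row: row `i` gets the weight
  -- `β i / q - 1`, because `β i` is idempotent.
  have hWW : W.transpose * W = 1 := by
    have hΔt : Δ.transpose = Δ := by rw [hΔ, Matrix.diagonal_transpose]
    calc W.transpose * W = V.transpose * (Δ * ((hadamardMatrix (exponent n)).transpose * hadamardMatrix (exponent n)) *
          Δ) * V := by
          rw [hW, Matrix.transpose_mul, Matrix.transpose_mul, hΔt]; simp only [Matrix.mul_assoc]
      _ = 1 := by
          rw [hadamardMatrix_transpose_mul_self, Matrix.mul_one, hΔ2, Matrix.mul_one, hVV]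
  have hSU : srhtMatrix m n (Sum.elim β fun i => sgn (ε i)) * U =
      Real.sqrt (N / m) • (Matrix.diagonal β * W) := by
    rw [srhtMatrix, Matrix.smul_mul, hW, hV, hN, hΔ]
    simp only [Matrix.mul_assoc]
    rfl
  have hentry : ∀ a b, (U.transpose * (srhtMatrix m n (Sum.elim β fun i => sgn (ε i))).transpose *
      srhtMatrix m n (Sum.elim β fun i => sgn (ε i)) * U - 1 : Matrix (Fin p) (Fin p) ℝ) a b =
      ∑ i, (β i / rate m n - 1) * N⁻¹ * (randomizedEntry (signMatrix (exponent n)) V ε i a *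
        randomizedEntry (signMatrix (exponent n)) V ε i b) := by
    intro a b
    rw [← Matrix.transpose_mul, Matrix.mul_assoc, hSU, ← hWW, Matrix.transpose_smul,
      Matrix.smul_mul, Matrix.mul_smul, smul_smul, Real.mul_self_sqrt (by positivity),
      Matrix.sub_apply, Matrix.smul_apply, Matrix.mul_apply, Matrix.mul_apply, smul_eq_mul,
      Finset.mul_sum, ← Finset.sum_sub_distrib]
    refine Finset.sum_congr rfl fun i _ => ?_
    rw [Matrix.transpose_apply, Matrix.transpose_apply, Matrix.diagonal_mul, Matrix.diagonal_mul,
      hX, hX]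
    have e2 : (Real.sqrt N)⁻¹ * (Real.sqrt N)⁻¹ = N⁻¹ := by
      rw [← mul_inv, Real.mul_self_sqrt hN0.le]
    have e3 : N / m = (rate m n)⁻¹ := by rw [hrm]; field_simp
    rw [e3]
    linear_combination ((rate m n)⁻¹ * (β i * β i) - 1) *
      (randomizedEntry (signMatrix (exponent n)) V ε i a * randomizedEntry (signMatrix (exponent n)) V ε i b) * e2 +
      (rate m n)⁻¹ * N⁻¹ *
      (randomizedEntry (signMatrix (exponent n)) V ε i a * randomizedEntry (signMatrix (exponent n)) V ε i b) * hβ i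
  have hinner : inner ℝ (quadForm m U (srhtMatrix m n (Sum.elim β fun i => sgn (ε i)))) t =
      Real.sqrt (m / (1 - rate m n)) * ∑ a, ∑ b, t (a, b) *
        (U.transpose * (srhtMatrix m n (Sum.elim β fun i => sgn (ε i))).transpose *
      srhtMatrix m n (Sum.elim β fun i => sgn (ε i)) * U - 1 : Matrix (Fin p) (Fin p) ℝ) a b := by
    rw [quadForm, real_inner_smul_left, PiLp.inner_apply, Fintype.sum_prod_type]
    simp only [vec, RCLike.inner_apply, conj_trivial]
  have hcard : (Fintype.card (Fin (2 ^ exponent n)) : ℝ) = N := by simp [hN]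
  rw [hinner, ← hV]
  simp_rw [hentry, rowForm, hcard, Matrix.of_apply]
  have hswap : (∑ a, ∑ b, t (a, b) * ∑ i, (β i / rate m n - 1) * N⁻¹ *
      (randomizedEntry (signMatrix (exponent n)) V ε i a * randomizedEntry (signMatrix (exponent n)) V ε i b)) =
      ∑ i, (β i / rate m n - 1) * N⁻¹ * ∑ a, ∑ b, t (a, b) *
        (randomizedEntry (signMatrix (exponent n)) V ε i a * randomizedEntry (signMatrix (exponent n)) V ε i b) := by
    simp_rw [Finset.mul_sum]
    refine ((Finset.sum_congr rfl fun a _ => Finset.sum_comm).trans Finset.sum_comm).trans ?_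
    exact Finset.sum_congr rfl fun i _ => Finset.sum_congr rfl fun a _ =>
      Finset.sum_congr rfl fun b _ => by ring
  rw [hswap, Finset.mul_sum, hrm]
  refine Finset.sum_congr rfl fun i _ => ?_
  rw [← mul_assoc, scale_identity hr0 hr hN0, mul_assoc]

theorem IsSRHT.ae_eq {Ω : Type*} [MeasurableSpace Ω] {P : Measure Ω} [IsProbabilityMeasure P]
    {m n : ℕ} {S : Ω → Matrix (Fin (2 ^ exponent n)) (Fin n) ℝ} (hS : IsSRHT P m n S) :
    ∃ (hm : m ≤ 2 ^ exponent n) (X : Ω → Fin (2 ^ exponent n) ⊕ Fin (2 ^ exponent n) → ℝ),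
      AEMeasurable X P ∧ (∀ᵐ ω ∂P, S ω = srhtMatrix m n (X ω)) ∧
      P.map X = ((coins _ half).prod (coins _ ⟨rate m n, rate_mem hm⟩)).map
        (fun x => Sum.elim (fun i => bit (x.2 i)) (fun i => sgn (x.1 i))) := by
  obtain ⟨hm, B, D, hi, hB, hD, hS⟩ := hS
  refine ⟨hm, fun ω i => Sum.elim B D i ω, ?_, hS, map_bernoulli_rademacher P _ B D hi hB hD⟩
  refine aemeasurable_pi_lambda _ ?_
  rintro (i | i)
  · exact (hB i).aemeasurable
  · exact (hD i).aemeasurable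

theorem IsSRHT.aemeasurable_quadForm {Ω : Type*} [MeasurableSpace Ω] {P : Measure Ω}
    [IsProbabilityMeasure P] {m n p : ℕ} {S : Ω → Matrix (Fin (2 ^ exponent n)) (Fin n) ℝ}
    (hS : IsSRHT P m n S) (U : Matrix (Fin n) (Fin p) ℝ) :
    AEMeasurable (fun ω => quadForm m U (S ω)) P := by
  obtain ⟨_, X, hX, hSX, _⟩ := hS.ae_eq
  refine ((continuous_quadForm_srhtMatrix m n U).measurable.comp_aemeasurable hX).congr ?_
  filter_upwards [hSX] with ω hω
  simp [hω]

/-- For fixed signs the exponent is linear in the independent sampling bits, so the inner integral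
of Fubini factors over the rows. -/
theorem IsSRHT.charFun_map_quadForm {Ω : Type*} [MeasurableSpace Ω] {P : Measure Ω}
    [IsProbabilityMeasure P] {m n p : ℕ} {S : Ω → Matrix (Fin (2 ^ exponent n)) (Fin n) ℝ}
    (hS : IsSRHT P m n S) (U : Matrix (Fin n) (Fin p) ℝ) (hU : U.transpose * U = 1)
    (hm : 0 < m) (hr : rate m n < 1) (t : EuclideanSpace ℝ (Fin p × Fin p)) :
    charFun (P.map fun ω => quadForm m U (S ω)) t =
      ∫ ε, ∏ i, bernoulliCharFun (rate m n)
        (rowForm (signMatrix (exponent n)) (paddingMatrix (2 ^ exponent n) n * U)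
          (Matrix.of fun a b => t (a, b)) ε i) ∂(coins (Fin (2 ^ exponent n)) half) := by
  obtain ⟨hmn, X, hX, hSX, hlaw⟩ := hS.ae_eq
  have hF := (continuous_quadForm_srhtMatrix m n U).measurable
  have h1 : P.map (fun ω => quadForm m U (S ω)) =
      (P.map X).map fun x => quadForm m U (srhtMatrix m n x) := by
    rw [AEMeasurable.map_map_of_aemeasurable hF.aemeasurable hX]
    refine Measure.map_congr ?_
    filter_upwards [hSX] with ω hω
    simp [hω]
  rw [h1, hlaw, Measure.map_map hF (measurable_of_finite _), charFun_apply,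
    integral_map (measurable_of_finite _).aemeasurable (by fun_prop),
    integral_prod _ Integrable.of_finite]
  refine integral_congr_ae (Filter.Eventually.of_forall fun ε => ?_)
  simp only [Function.comp_apply]
  set y := rowForm (signMatrix (exponent n)) (paddingMatrix (2 ^ exponent n) n * U)
          (Matrix.of fun a b => t (a, b)) ε with hy
  set q := rate m n with hq
  have h2 : ∀ b : Fin (2 ^ exponent n) → Bool,
      Complex.exp ((inner ℝ (quadForm m U (srhtMatrix m n (Sum.elim (fun i => bit (b i))
        fun i => sgn (ε i)))) t : ℝ) * Complex.I) =
      ∏ i, Complex.exp (((bit (b i) - q) / Real.sqrt (q * (1 - q)) * y i : ℝ) * Complex.I) := by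
    intro b
    rw [inner_quadForm_srhtMatrix U hU hm hr _ (fun i => bit_mul_self _), ← Complex.exp_sum,
      Complex.ofReal_sum, Finset.sum_mul]
  simp_rw [h2]
  rw [integral_coins_prod (𝕜 := ℂ) _
    (fun i b => Complex.exp (((bit b - q) / Real.sqrt (q * (1 - q)) * y i : ℝ) * Complex.I))]
  refine Finset.prod_congr rfl fun i _ => ?_
  simp [bernoulliCharFun, bit, hq]

/-! ### The limiting covariance -/

theorem dotProduct_limitCov_mulVec {p : ℕ} (t : Fin p × Fin p → ℝ) :
    t ⬝ᵥ (limitCov p).mulVec t = limitForm (Matrix.of fun a b => t (a, b)) := by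
  have h1 : ∀ x, (transpositionMatrix p).mulVec t x = t (x.2, x.1) := by
    intro x
    rw [Matrix.mulVec, dotProduct, Finset.sum_eq_single (x.2, x.1)]
    · simp [transpositionMatrix]
    · intro y _ hy
      have : ¬ (x.1 = y.2 ∧ x.2 = y.1) := fun h => hy (Prod.ext h.2.symm h.1.symm)
      simp [transpositionMatrix, this]
    · simp
  have h2 : ∀ s : Fin p × Fin p → ℝ, vec (1 : Matrix (Fin p) (Fin p) ℝ) ⬝ᵥ s = ∑ a, s (a, a) := by
    intro s
    simp [dotProduct, vec, Fintype.sum_prod_type, Matrix.one_apply]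
  rw [limitCov, Matrix.add_mulVec, Matrix.add_mulVec, Matrix.one_mulVec, dotProduct_add,
    dotProduct_add, identityOuter, Matrix.vecMulVec_mulVec, h2, limitForm]
  have h3 : t ⬝ᵥ (transpositionMatrix p).mulVec t = ∑ a, ∑ b, t (a, b) * t (b, a) := by
    simp_rw [dotProduct, h1, Fintype.sum_prod_type]
  have h4 : t ⬝ᵥ t = ∑ a, ∑ b, t (a, b) ^ 2 := by
    simp_rw [dotProduct, Fintype.sum_prod_type, sq]
  have h5 : t ⬝ᵥ (MulOpposite.op (∑ a, t (a, a)) • vec (1 : Matrix (Fin p) (Fin p) ℝ)) =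
      (∑ a, t (a, a)) ^ 2 := by
    rw [dotProduct_smul, dotProduct_comm, h2]; simp [sq]
  rw [h3, h4, h5]
  simp only [Matrix.trace, Matrix.diag, Matrix.of_apply]
  ring

/-- The last two terms together are half the squared Frobenius norm of `T + Tᵀ`. -/
theorem limitForm_nonneg {p : ℕ} (T : Matrix (Fin p) (Fin p) ℝ) : 0 ≤ limitForm T := by
  have h1 : ∑ a, ∑ b, T a b ^ 2 + ∑ a, ∑ b, T a b * T b a =
      (∑ a, ∑ b, (T a b + T b a) ^ 2) / 2 := by
    have : ∑ a, ∑ b, T b a ^ 2 = ∑ a, ∑ b, T a b ^ 2 := Finset.sum_comm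
    simp_rw [add_sq, Finset.sum_add_distrib, this, mul_assoc, ← Finset.mul_sum]
    ring
  have h2 : 0 ≤ ∑ a, ∑ b, (T a b + T b a) ^ 2 :=
    Finset.sum_nonneg fun _ _ => Finset.sum_nonneg fun _ _ => sq_nonneg _
  rw [limitForm, add_assoc, h1]
  positivity

theorem posSemidef_limitCov (p : ℕ) : (limitCov p).PosSemidef := by
  refine Matrix.PosSemidef.of_dotProduct_mulVec_nonneg ?_ fun t => ?_
  · ext x y
    simp only [limitCov, transpositionMatrix, identityOuter, Matrix.conjTranspose_apply,
      Matrix.add_apply, Matrix.of_apply, Matrix.vecMulVec_apply, star_trivial, Matrix.one_apply,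
      eq_comm (a := y) (b := x)]
    congr 1
    · congr 1
      exact if_congr ⟨fun h => ⟨h.2.symm, h.1.symm⟩, fun h => ⟨h.2.symm, h.1.symm⟩⟩ rfl rfl
    · exact mul_comm _ _
  · rw [star_trivial, dotProduct_limitCov_mulVec]
    exact limitForm_nonneg _

/-- The Frobenius term is `|a|² |b|² > 0`, and the other two terms are squares. -/
theorem limitForm_vecMulVec_pos {p : ℕ} {a b : Fin p → ℝ} (ha : a ≠ 0) (hb : b ≠ 0) :
    0 < limitForm (Matrix.vecMulVec a b) := by
  have h1 : ∑ i, ∑ j, Matrix.vecMulVec a b i j ^ 2 = (a ⬝ᵥ a) * (b ⬝ᵥ b) := by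
    simp_rw [Matrix.vecMulVec_apply, dotProduct, Finset.sum_mul_sum]
    exact Finset.sum_congr rfl fun i _ => Finset.sum_congr rfl fun j _ => by ring
  have h2 : ∑ i, ∑ j, Matrix.vecMulVec a b i j * Matrix.vecMulVec a b j i = (a ⬝ᵥ b) ^ 2 := by
    simp_rw [Matrix.vecMulVec_apply, dotProduct, sq, Finset.sum_mul_sum]
    exact Finset.sum_congr rfl fun i _ => Finset.sum_congr rfl fun j _ => by ring
  have pos : ∀ {c : Fin p → ℝ}, c ≠ 0 → 0 < c ⬝ᵥ c := fun {c} hc => by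
    have h0 : 0 ≤ c ⬝ᵥ c := Finset.sum_nonneg fun i _ => mul_self_nonneg _
    exact lt_of_le_of_ne h0 fun h => hc (dotProduct_self_eq_zero.1 h.symm)
  rw [limitForm, h1, h2]
  have := mul_pos (pos ha) (pos hb)
  positivity

/-! ### The limit theorem -/

theorem tendsto_charFun_map_quadForm (p : ℕ) (n m : ℕ → ℕ)
    (U : ∀ k, Matrix (Fin (n k)) (Fin p) ℝ)
    {Ω : ℕ → Type*} [∀ k, MeasurableSpace (Ω k)]
    (P : ∀ k, Measure (Ω k)) [∀ k, IsProbabilityMeasure (P k)]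
    (S : ∀ k, Ω k → Matrix (Fin (2 ^ exponent (n k))) (Fin (n k)) ℝ)
    (hS : ∀ k, IsSRHT (P k) (m k) (n k) (S k))
    (hU : ∀ k, (U k).transpose * U k = 1)
    (hlev : Tendsto (fun k => maxRowNorm (U k)) atTop (𝓝 0))
    (hm : Tendsto (fun k => (m k : ℝ)) atTop atTop)
    (hγ : limsup (fun k => rate (m k) (n k)) atTop < 1) (t : EuclideanSpace ℝ (Fin p × Fin p)) :
    Tendsto (fun k => charFun ((P k).map fun ω => quadForm (m k) (U k) (S k ω)) t) atTop
      (𝓝 (Complex.exp (-(limitForm (Matrix.of fun a b => t (a, b)) / 2 : ℝ)))) := by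
  set T : Matrix (Fin p) (Fin p) ℝ := Matrix.of fun a b => t (a, b) with hT
  obtain ⟨c, hc1, hc2⟩ := exists_between hγ
  -- A real `limsup` carries information only for sequences bounded above; here rates are at most 1.
  have hbdd : IsBoundedUnder (· ≤ ·) atTop fun k => rate (m k) (n k) :=
    isBoundedUnder_of ⟨1, fun k => (rate_mem (hS k).1).2⟩
  have hrate : ∀ᶠ k in atTop, rate (m k) (n k) < c := eventually_lt_of_limsup_lt hc1 hbdd
  have hm0 : ∀ᶠ k in atTop, 0 < m k := by
    filter_upwards [hm.eventually_gt_atTop 0] with k hk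
    exact_mod_cast hk
  have hscale : Tendsto (fun k => (m k : ℝ) * (1 - rate (m k) (n k))) atTop atTop := by
    refine tendsto_atTop_mono' _ ?_ (hm.atTop_mul_const (sub_pos.2 hc2))
    filter_upwards [hrate] with k hk
    exact mul_le_mul_of_nonneg_left (by linarith) (Nat.cast_nonneg _)
  have hinv : Tendsto (fun k => (Real.sqrt ((m k : ℝ) * (1 - rate (m k) (n k))))⁻¹) atTop (𝓝 0) :=
    tendsto_inv_atTop_zero.comp (Real.tendsto_sqrt_atTop.comp hscale)
  have hε : Tendsto (fun k => maxRowNorm (U k) ^ 2) atTop (𝓝 0) := by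
    simpa using hlev.pow 2
  have hbound : Tendsto (fun k =>
      5 * (absSum T ^ 3 * (p ^ 2 * (p * (720 * Real.exp (1 / 2))))) *
          (Real.sqrt ((m k : ℝ) * (1 - rate (m k) (n k))))⁻¹ +
        (1 / 2) * (2 * (absSum T * maxRowNorm (U k) ^ 2 * (absSum T * p)) +
        Real.sqrt (256 * (absSum T * maxRowNorm (U k) ^ 2 * (absSum T * p) ^ 3)))) atTop
      (𝓝 0) := by
    have h1 := hinv.const_mul (5 * (absSum T ^ 3 * (p ^ 2 * (p * (720 * Real.exp (1 / 2))))))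
    have h2 := ((hε.const_mul (absSum T)).mul_const (absSum T * p)).const_mul 2
    have h3 := (((hε.const_mul (absSum T)).mul_const ((absSum T * p) ^ 3)).const_mul 256).sqrt
    simpa only [mul_zero, zero_mul, add_zero, Real.sqrt_zero] using
      h1.add ((h2.add h3).const_mul (1 / 2))
  rw [tendsto_iff_norm_sub_tendsto_zero]
  refine squeeze_zero' (Eventually.of_forall fun _ => norm_nonneg _) ?_ hbound
  filter_upwards [hrate, hm0] with k hk hk0
  have hk1 : rate (m k) (n k) < 1 := hk.trans hc2
  have hq0 : 0 < rate (m k) (n k) := by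
    have : (0 : ℝ) < m k := by exact_mod_cast hk0
    unfold rate; positivity
  rw [(hS k).charFun_map_quadForm (U k) (hU k) hk0 hk1 t]
  refine ((isHadamard_signMatrix (exponent (n k))).norm_integral_prod_bernoulliCharFun_rowForm_sub_le
    _ (padding_mul_transpose_mul_self (U k) (hU k)) T _ (sum_padding_mul_sq_le (U k)) hq0 hk1
    (limitForm_nonneg T)).trans (le_of_eq ?_)
  -- `N γ = m` turns the Lindeberg error into a power of `m (1 - γ)`, which tends to infinity since
  -- `γ` stays below `c < 1`.
  have hN : (Fintype.card (Fin (2 ^ exponent (n k))) : ℝ) *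
      (rate (m k) (n k) * (1 - rate (m k) (n k))) = m k * (1 - rate (m k) (n k)) := by
    rw [← mul_assoc]
    congr 1
    rw [rate, Fintype.card_fin]
    push_cast
    field_simp
  rw [hN]

end SRHT

theorem mainTheorem4 (p : ℕ) (n m : ℕ → ℕ)
    (U : ∀ k, Matrix (Fin (n k)) (Fin p) ℝ)
    {Ω : ℕ → Type*} [∀ k, MeasurableSpace (Ω k)]
    (P : ∀ k, Measure (Ω k)) [∀ k, IsProbabilityMeasure (P k)]
    (S : ∀ k, Ω k → Matrix (Fin (2 ^ SRHT.exponent (n k))) (Fin (n k)) ℝ)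
    (hS : ∀ k, SRHT.IsSRHT (P k) (m k) (n k) (S k))
    (hU : ∀ k, (U k).transpose * U k = 1)
    (hlev : Tendsto (fun k => SRHT.maxRowNorm (U k)) atTop (𝓝 0))
    (hn : Tendsto n atTop atTop)
    (hm : Tendsto (fun k => (m k : ℝ) / Real.log (n k) ^ 2) atTop atTop)
    (hγ : limsup (fun k => SRHT.rate (m k) (n k)) atTop < 1) :
    (SRHT.limitCov p).PosSemidef ∧
    (∀ a b : Fin p → ℝ, a ≠ 0 → b ≠ 0 →
      0 < SRHT.vec (Matrix.vecMulVec a b) ⬝ᵥ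
        (SRHT.limitCov p).mulVec (SRHT.vec (Matrix.vecMulVec a b))) ∧
    TendstoInDistribution (fun k ω => SRHT.quadForm (m k) (U k) (S k ω)) atTop
      (id : EuclideanSpace ℝ (Fin p × Fin p) → EuclideanSpace ℝ (Fin p × Fin p))
      P (multivariateGaussian 0 (SRHT.limitCov p)) := by
  refine ⟨SRHT.posSemidef_limitCov p, fun a b ha hb => ?_, ?_⟩
  · rw [SRHT.dotProduct_limitCov_mulVec]
    exact SRHT.limitForm_vecMulVec_pos ha hb
  -- Once `log n ≥ 1`, dividing by its square only decreases `m`.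
  have hm' : Tendsto (fun k => (m k : ℝ)) atTop atTop := by
    refine tendsto_atTop_mono' _ ?_ hm
    have hlog : Tendsto (fun k => Real.log (n k)) atTop atTop :=
      Real.tendsto_log_atTop.comp (tendsto_natCast_atTop_atTop.comp hn)
    filter_upwards [hlog.eventually_ge_atTop 1] with k hk
    exact div_le_self (Nat.cast_nonneg _) (one_le_pow₀ hk)
  refine ⟨fun k => (hS k).aemeasurable_quadForm (U k), aemeasurable_id, ?_⟩
  refine ProbabilityMeasure.tendsto_iff_tendsto_charFun.2 fun t => ?_
  simp only [ProbabilityMeasure.coe_mk, Measure.map_id]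
  rw [charFun_multivariateGaussian (SRHT.posSemidef_limitCov p)]
  convert SRHT.tendsto_charFun_map_quadForm p n m U P S hS hU hlev hm' hγ t using 3
  rw [SRHT.dotProduct_limitCov_mulVec]
  simp
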